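/- Let $W\in C^2(\mathbb R;\mathbb R)$ with $W,W',W''$ bounded. For $b>0$ and $k\in\mathbb R$ let $h(k)=-\frac{d^2}{dx^2}+(bx-k)^2+W(x)$ be the self-adjoint operator in $L^2(\mathbb R)$ obtained as the closure from $C_0^\infty(\mathbb R)$; its spectrum is discrete and simple, and $E_1(k;b,W)<E_2(k;b,W)<\dots$ denotes the increasing sequence of its eigenvalues. Primes on $E_j$ denote derivatives with respect to $k$. Fix $j\in\mathbb N=\{1,2,\dots\}$. (i) If $x_0\in\mathbb R$ and $W'(x_0)>0$ (resp. $W'(x_0)<0$), then there is $b_0>0$, depending only on $W$, $j$ and $x_0$, such that for every $b>b_0$ the function $E_j(\cdot;b,W)$ is differentiable at $bx_0$ and $E_j'(bx_0;b,W)>0$ (resp. $E_j'(bx_0;b,W)<0$). (ii) For every $b>2\|W\|_{L^\infty(\mathbb R)}$ and every $k\in\mathbb R$ the function $E_j(\cdot;b,W)$ is differentiable at $k$ and $$\left|E_j'(k;b,W)-b^{-1}W'(k/b)\right|\le c_1b^{-2}+c_2b^{-3/2},$$ where $$c_1=\|W\|_{L^\infty}\|W'\|_{L^\infty}\Bigl(\sum_{l=1}^\infty(2|l-j|-1)^{-2}\Bigr)^{1/2}\Bigl(\sum_{l\in\mathbb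 N,\,l\ne j}\bigl(2|l-j|-\tfrac32\bigr)^{-2}+4\Bigr)^{1/2},\qquad c_2=\|W''\|_{L^\infty}\int_{\mathbb R}|y|\,\varphi_j(y)^2\,dy,$$ and $\varphi_j$ is the real $L^2(\mathbb R)$-normalized solution of $-\varphi_j''+y^2\varphi_j=(2j-1)\varphi_j$, i.e. the normalized Hermite function of degree $j-1$. -/

import Mathlib

open MeasureTheory Set

open scoped ContDiff

namespace EdgePotential

/-- The complex Hilbert space `L²(ℝ)`. -/
abbrev L2R : Type := Lp ℂ 2 (volume : Measure ℝ)

/-- The differential expression `-φ'' + (b x - k)² φ + W φ`. -/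
noncomputable def fiberExpr (b : ℝ) (W : ℝ → ℝ) (k : ℝ) (φ : ℝ → ℂ) (x : ℝ) : ℂ :=
  -deriv (deriv φ) x + (((b * x - k) ^ 2 + W x : ℝ) : ℂ) * φ x

theorem deriv2_add {φ ψ : ℝ → ℂ} (hφ : ContDiff ℝ ∞ φ) (hψ : ContDiff ℝ ∞ ψ) (x : ℝ) :
    deriv (deriv (φ + ψ)) x = deriv (deriv φ) x + deriv (deriv ψ) x := by
  have h1 : deriv (φ + ψ) = deriv φ + deriv ψ := by
    funext y
    exact deriv_add (hφ.differentiable (by simp) y) (hψ.differentiable (by simp) y)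
  have h2 : ∀ {f : ℝ → ℂ}, ContDiff ℝ ∞ f → DifferentiableAt ℝ (deriv f) x := fun hf =>
    ((contDiff_infty_iff_deriv.1 hf).2.differentiable (by simp)) x
  rw [h1]
  exact deriv_add (h2 hφ) (h2 hψ)

theorem deriv2_smul (c : ℂ) {φ : ℝ → ℂ} (hφ : ContDiff ℝ ∞ φ) (x : ℝ) :
    deriv (deriv (c • φ)) x = c * deriv (deriv φ) x := by
  have h1 : deriv (c • φ) = c • deriv φ := by
    funext y
    exact deriv_const_smul c (hφ.differentiable (by simp) y)
  rw [h1]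
  exact deriv_const_smul c
    (((contDiff_infty_iff_deriv.1 hφ).2.differentiable (by simp)) x)

theorem fiberExpr_add (b : ℝ) (W : ℝ → ℝ) (k : ℝ) {φ ψ : ℝ → ℂ} (hφ : ContDiff ℝ ∞ φ)
    (hψ : ContDiff ℝ ∞ ψ) (x : ℝ) :
    fiberExpr b W k (φ + ψ) x = fiberExpr b W k φ x + fiberExpr b W k ψ x := by
  simp only [fiberExpr, deriv2_add hφ hψ, Pi.add_apply]
  ring

theorem fiberExpr_smul (b : ℝ) (W : ℝ → ℝ) (k : ℝ) (c : ℂ) {φ : ℝ → ℂ}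
    (hφ : ContDiff ℝ ∞ φ) (x : ℝ) :
    fiberExpr b W k (c • φ) x = c * fiberExpr b W k φ x := by
  simp only [fiberExpr, deriv2_smul c hφ, Pi.smul_apply, smul_eq_mul]
  ring

/-- The graph in `L²(ℝ) × L²(ℝ)` of `-d²/dx² + (b x - k)² + W(x)` on `C₀^∞(ℝ)`. -/
def minimalGraph (b : ℝ) (W : ℝ → ℝ) (k : ℝ) : Submodule ℂ (L2R × L2R) where
  carrier := {p | ∃ φ : ℝ → ℂ, ContDiff ℝ ∞ φ ∧ HasCompactSupport φ ∧
    p.1 =ᵐ[volume] φ ∧ p.2 =ᵐ[volume] fiberExpr b W k φ}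
  add_mem' := by
    rintro p q ⟨φ, hφ, hφc, hp1, hp2⟩ ⟨ψ, hψ, hψc, hq1, hq2⟩
    refine ⟨φ + ψ, hφ.add hψ, hφc.add hψc, ?_, ?_⟩
    · filter_upwards [Lp.coeFn_add p.1 q.1, hp1, hq1] with x h a c
      exact h.trans (congrArg₂ (· + ·) a c)
    · filter_upwards [Lp.coeFn_add p.2 q.2, hp2, hq2] with x h a c
      exact h.trans ((congrArg₂ (· + ·) a c).trans (fiberExpr_add b W k hφ hψ x).symm)
  zero_mem' := by
    refine ⟨0, contDiff_const, HasCompactSupport.zero, Lp.coeFn_zero _ _ _, ?_⟩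
    filter_upwards [Lp.coeFn_zero ℂ 2 (volume : Measure ℝ)] with x h
    exact h.trans (by simp [fiberExpr])
  smul_mem' := by
    rintro c p ⟨φ, hφ, hφc, hp1, hp2⟩
    refine ⟨c • φ, contDiff_const.smul hφ, hφc.smul_left (f := fun _ => c), ?_, ?_⟩
    · filter_upwards [Lp.coeFn_smul c p.1, hp1] with x h a
      simp [h, a]
    · filter_upwards [Lp.coeFn_smul c p.2, hp2] with x h a
      simp [h, a, fiberExpr_smul b W k c hφ]

theorem minimalGraph_functional (b : ℝ) (W : ℝ → ℝ) (k : ℝ) :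
    ∀ p ∈ minimalGraph b W k, p.1 = 0 → p.2 = 0 := by
  rintro p ⟨φ, hφ, -, h1, h2⟩ h0
  have hz : φ = 0 := by
    refine Continuous.ae_eq_iff_eq volume hφ.continuous continuous_const |>.1 ?_
    rw [h0] at h1
    exact h1.symm.trans (Lp.coeFn_zero _ _ _)
  rw [Lp.eq_zero_iff_ae_eq_zero]
  filter_upwards [h2] with x hx
  simp [hx, hz, fiberExpr]

/-- `-d²/dx² + (b x - k)² + W(x)` as an operator in `L²(ℝ)` with domain `C₀^∞(ℝ)`. -/
noncomputable def minimalOp (b : ℝ) (W : ℝ → ℝ) (k : ℝ) : L2R →ₗ.[ℂ] L2R :=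
  (minimalGraph b W k).toLinearPMap

theorem minimalOp_graph (b : ℝ) (W : ℝ → ℝ) (k : ℝ) :
    (minimalOp b W k).graph = minimalGraph b W k :=
  Submodule.toLinearPMap_graph_eq _ (minimalGraph_functional b W k)

/-- The operator `h(k) = -d²/dx² + (b x - k)² + W(x)` in `L²(ℝ)`: the closure of its restriction
to `C₀^∞(ℝ)`, which is self-adjoint for real bounded `W`. -/
noncomputable def fiberOp (b : ℝ) (W : ℝ → ℝ) (k : ℝ) : L2R →ₗ.[ℂ] L2R :=
  (minimalOp b W k).closure

/-- The set of (real) eigenvalues of an operator in `L²(ℝ)`. -/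
def eigenvalueSet (T : L2R →ₗ.[ℂ] L2R) : Set ℝ :=
  {lam | ∃ u : T.domain, (u : L2R) ≠ 0 ∧ T u = (lam : ℂ) • (u : L2R)}

/-- The increasing enumeration, starting at index `0`, of a set of reals that is bounded below,
infinite and discrete. -/
noncomputable def increasingEnum (S : Set ℝ) : ℕ → ℝ
  | 0 => sInf S
  | n + 1 => sInf (S ∩ Ioi (increasingEnum S n))

/-- The band function `E_j(k; b, W)`, `j = 1, 2, …`: the `j`-th term of the increasing sequence of
the eigenvalues of `h(k)`. For `b > 0` and bounded `W` the spectrum of `h(k)` is discrete, simple,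
infinite and bounded below. -/
noncomputable def bandFun (b : ℝ) (W : ℝ → ℝ) (j : ℕ) (k : ℝ) : ℝ :=
  increasingEnum (eigenvalueSet (fiberOp b W k)) (j - 1)

/-- The norm of a bounded continuous function in `L^∞(ℝ)`. -/
noncomputable def supNorm (f : ℝ → ℝ) : ℝ := ⨆ x, |f x|

/-- `He_n(√2 y) exp(-y²/2)`, where `He_n` is the probabilists' Hermite polynomial; up to a constant
factor, `He_n(√2 y)` is the physicists' Hermite polynomial `H_n(y)`. -/
noncomputable def hermiteAux (n : ℕ) (y : ℝ) : ℝ :=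
  Polynomial.aeval (√2 * y) (Polynomial.hermite n) * Real.exp (-y ^ 2 / 2)

/-- The function `φ_j`, `j = 1, 2, …`, with `-φ_j'' + y² φ_j = (2 j - 1) φ_j` and
`‖φ_j‖_{L²(ℝ)} = 1`. -/
noncomputable def hermiteFun (j : ℕ) (y : ℝ) : ℝ :=
  hermiteAux (j - 1) y / √(∫ z, hermiteAux (j - 1) z ^ 2)

/-- The constant `c₁`. -/
noncomputable def c₁ (W : ℝ → ℝ) (j : ℕ) : ℝ :=
  supNorm W * supNorm (deriv W) *
    √(∑' l : ℕ+, ((2 * |(l : ℝ) - (j : ℝ)| - 1) ^ 2)⁻¹) *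
    √((∑' l : {l : ℕ+ // (l : ℕ) ≠ j}, ((2 * |((l : ℕ+) : ℝ) - (j : ℝ)| - 3 / 2) ^ 2)⁻¹) + 4)

/-- The constant `c₂`. -/
noncomputable def c₂ (W : ℝ → ℝ) (j : ℕ) : ℝ :=
  supNorm (deriv (deriv W)) * ∫ y, |y| * hermiteFun j y ^ 2

end EdgePotential

namespace EdgePotential

section Perturbation

open Filter Topology

variable {H : Type*} [NormedAddCommGroup H] [InnerProductSpace ℂ H]

theorem hasSum_norm_inner_sq (e : HilbertBasis ℕ ℂ H) (x : H) :
    HasSum (fun m => ‖inner ℂ (e m) x‖ ^ 2) (‖x‖ ^ 2) := by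
  have h := Complex.hasSum_re (e.hasSum_inner_mul_inner x x)
  have h2 : (inner ℂ x x).re = ‖x‖ ^ 2 := by
    rw [inner_self_eq_norm_sq_to_K]; norm_cast
  rw [h2] at h
  refine h.congr_fun fun m => ?_
  rw [← inner_conj_symm x (e m), Complex.conj_mul']
  norm_cast

theorem norm_le_of_norm_inner_le (e : HilbertBasis ℕ ℂ H) {x y : H}
    (h : ∀ m, ‖inner ℂ (e m) x‖ ≤ ‖inner ℂ (e m) y‖) : ‖x‖ ≤ ‖y‖ := by
  refine (sq_le_sq₀ (norm_nonneg _) (norm_nonneg _)).1 ?_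
  exact hasSum_le (fun m => by gcongr; exact h m) (hasSum_norm_inner_sq e x)
    (hasSum_norm_inner_sq e y)

/-- In the Hilbert basis `e`, `u` solves `(D + A) u = lam u` for the diagonal operator `D` with
eigenvalues `2 m + 1`. -/
def IsEig (e : HilbertBasis ℕ ℂ H) (A : H →L[ℂ] H) (lam : ℂ) (u : H) : Prop :=
  ∀ m : ℕ, (lam - (2 * m + 1)) * inner ℂ (e m) u = inner ℂ (e m) (A u)

theorem IsEig.smul {e : HilbertBasis ℕ ℂ H} {A : H →L[ℂ] H} {lam : ℂ} {u : H}
    (h : IsEig e A lam u) (c : ℂ) : IsEig e A lam (c • u) := by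
  intro m
  rw [map_smul, inner_smul_right, inner_smul_right, ← h m]
  ring

theorem two_le_norm_odd_sub {m n : ℕ} (hmn : m ≠ n) :
    (2 : ℝ) ≤ ‖((2 * n + 1 : ℂ) - (2 * m + 1))‖ := by
  have h1 : ((2 * n + 1 : ℂ) - (2 * m + 1)) = ((2 * ((n : ℤ) - m) : ℤ) : ℂ) := by
    push_cast; ring
  rw [h1, Complex.norm_intCast]
  have h2 : (2 : ℤ) ≤ |2 * ((n : ℤ) - m)| := by
    rw [abs_mul]
    have : 1 ≤ |(n : ℤ) - m| := Int.one_le_abs (by omega)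
    simp only [abs_two]
    omega
  exact_mod_cast h2

theorem gap_le_norm_sub {lam : ℂ} {n m : ℕ} {r : ℝ} (hr : ‖lam - (2 * n + 1)‖ ≤ r)
    (hmn : m ≠ n) : 2 - r ≤ ‖lam - (2 * m + 1)‖ := by
  have h1 := two_le_norm_odd_sub hmn
  have h2 : ((2 * n + 1 : ℂ) - (2 * m + 1)) = (lam - (2 * m + 1)) - (lam - (2 * n + 1)) := by ring
  have h3 := norm_sub_le (lam - (2 * m + 1)) (lam - (2 * n + 1))
  rw [← h2] at h3
  linarith

/-- The lower bound for `lam - D` on the orthogonal complement of `e n`. -/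
theorem gap_mul_norm_le (e : HilbertBasis ℕ ℂ H) {lam : ℂ} {n : ℕ} {r : ℝ}
    (hr : ‖lam - (2 * n + 1)‖ ≤ r) (hr2 : r ≤ 2) {x y : H} (hx : inner ℂ (e n) x = 0)
    (hxy : ∀ m, m ≠ n → (lam - (2 * m + 1)) * inner ℂ (e m) x = inner ℂ (e m) y) :
    (2 - r) * ‖x‖ ≤ ‖y‖ := by
  have h : ‖((2 - r : ℝ) : ℂ) • x‖ ≤ ‖y‖ := by
    refine norm_le_of_norm_inner_le e fun m => ?_
    rw [inner_smul_right, norm_mul, Complex.norm_real, Real.norm_of_nonneg (by linarith)]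
    by_cases hm : m = n
    · subst hm; simp [hx]
    · rw [← hxy m hm, norm_mul]
      gcongr
      exact gap_le_norm_sub hr hm
  rwa [norm_smul, Complex.norm_real, Real.norm_of_nonneg (by linarith)] at h

theorem exists_reduced_resolvent (e : HilbertBasis ℕ ℂ H) {lam : ℂ} {n : ℕ} {r : ℝ}
    (hr : ‖lam - (2 * n + 1)‖ ≤ r) (hr1 : r ≤ 1) (y : H) :
    ∃ x : H, inner ℂ (e n) x = 0 ∧
      ∀ m, m ≠ n → (lam - (2 * m + 1)) * inner ℂ (e m) x = inner ℂ (e m) y := by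
  classical
  let f : ℕ → ℂ := fun m => if m = n then 0 else (lam - (2 * m + 1))⁻¹ * inner ℂ (e m) y
  have hpos : ∀ m, m ≠ n → 1 ≤ ‖lam - (2 * m + 1)‖ := fun m hm => by
    linarith [gap_le_norm_sub hr hm]
  have hf : Memℓp f 2 := by
    refine memℓp_gen ?_
    have : (2 : ENNReal).toReal = ((2 : ℕ) : ℝ) := by simp
    simp only [this, Real.rpow_natCast]
    refine Summable.of_nonneg_of_le (fun m => by positivity) (fun m => ?_)
      (hasSum_norm_inner_sq e y).summable
    by_cases hm : m = n
    · simp [f, hm]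
    · simp only [f, hm, if_false, norm_mul, norm_inv]
      gcongr
      have := inv_le_one_of_one_le₀ (hpos m hm)
      nlinarith [norm_nonneg (inner ℂ (e m) y)]
  refine ⟨e.repr.symm ⟨f, hf⟩, ?_, fun m hm => ?_⟩
  · rw [← e.repr_apply_apply]; simp [f]
  · rw [← e.repr_apply_apply]
    have : lam - (2 * m + 1) ≠ 0 := by
      rw [← norm_ne_zero_iff]; linarith [hpos m hm]
    simp only [LinearIsometryEquiv.apply_symm_apply, f, hm, if_false]
    field_simp

theorem inner_sub_of_inner_eq_one (e : HilbertBasis ℕ ℂ H) {n : ℕ} {u : H}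
    (hu : inner ℂ (e n) u = 1) : inner ℂ (e n) (u - e n) = 0 := by
  rw [inner_sub_right, hu, inner_self_eq_norm_sq_to_K, e.orthonormal.1 n]; simp

theorem inner_of_ne (e : HilbertBasis ℕ ℂ H) {n m : ℕ} (h : m ≠ n) : inner ℂ (e m) (e n) = 0 :=
  e.orthonormal.2 h

theorem inner_basis_self (e : HilbertBasis ℕ ℂ H) (n : ℕ) : inner ℂ (e n) (e n) = 1 := by
  rw [inner_self_eq_norm_sq_to_K, e.orthonormal.1 n]; simp

theorem norm_apply_le_of_le {A : H →L[ℂ] H} {w : ℝ} (hA : ‖A‖ ≤ w) (x : H) : ‖A x‖ ≤ w * ‖x‖ :=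
  (A.le_opNorm x).trans (by gcongr)

theorem norm_inner_basis_le (e : HilbertBasis ℕ ℂ H) (n : ℕ) (x : H) :
    ‖inner ℂ (e n) x‖ ≤ ‖x‖ := by
  have := norm_inner_le_norm (𝕜 := ℂ) (e n) x
  rwa [e.orthonormal.1 n, one_mul] at this

/-- Every eigenvalue of `D + A` is at distance at most `‖A‖` from the spectrum of `D`. -/
theorem IsEig.exists_near (e : HilbertBasis ℕ ℂ H) {A : H →L[ℂ] H} {w : ℝ} (hA : ‖A‖ ≤ w)
    {lam : ℂ} {u : H} (h : IsEig e A lam u) (hu : u ≠ 0) :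
    ∃ n : ℕ, ‖lam - (2 * n + 1)‖ ≤ w := by
  by_contra! hc
  have hw : 0 ≤ w := (norm_nonneg _).trans hA
  obtain ⟨m, hm⟩ : ∃ m, inner ℂ (e m) u ≠ 0 := by
    by_contra! h0
    apply hu
    rw [← norm_eq_zero]
    have := norm_le_of_norm_inner_le e (x := u) (y := 0) (fun m => by simp [h0 m])
    simpa using this
  have h1 := hasSum_norm_inner_sq e ((w : ℂ) • u)
  have h2 := hasSum_norm_inner_sq e (A u)
  have key : ∀ m, ‖inner ℂ (e m) ((w : ℂ) • u)‖ = w * ‖inner ℂ (e m) u‖ := fun m => by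
    rw [inner_smul_right, norm_mul, Complex.norm_real, Real.norm_of_nonneg hw]
  have h3 : ‖(w : ℂ) • u‖ ^ 2 < ‖A u‖ ^ 2 := by
    refine hasSum_lt (i := m) (fun k => ?_) ?_ h1 h2
    · change ‖_‖ ^ 2 ≤ ‖_‖ ^ 2
      rw [key, ← h k, norm_mul]
      gcongr
      exact (hc k).le
    · rw [key, ← h m, norm_mul]
      have := norm_pos_iff.2 hm
      gcongr
      exact hc m
  have h4 := norm_apply_le_of_le hA u
  rw [norm_smul, Complex.norm_real, Real.norm_of_nonneg hw] at h3
  nlinarith [norm_nonneg (A u), mul_nonneg hw (norm_nonneg u)]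

theorem IsEig.im_eq_zero (e : HilbertBasis ℕ ℂ H) {A : H →L[ℂ] H}
    (hs : (A : H →ₗ[ℂ] H).IsSymmetric) {lam : ℂ} {u : H} (h : IsEig e A lam u) (hu : u ≠ 0) :
    lam.im = 0 := by
  have h1 := Complex.hasSum_im (e.hasSum_inner_mul_inner u (A u))
  have h2 : (inner ℂ u (A u)).im = 0 := by
    have : inner ℂ (A u) u = inner ℂ u (A u) := hs u u
    rw [← inner_conj_symm] at this
    exact Complex.conj_eq_iff_im.1 this
  have h3 := (hasSum_norm_inner_sq e u).mul_left lam.im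
  have h4 : (fun m => (inner ℂ u (e m) * inner ℂ (e m) (A u)).im) =
      fun m => lam.im * ‖inner ℂ (e m) u‖ ^ 2 := by
    funext m
    rw [← h m, ← inner_conj_symm u (e m), mul_left_comm, Complex.conj_mul', Complex.mul_im]
    norm_cast
    simp
  rw [h4, h2] at h1
  have h5 := h3.unique h1
  rcases mul_eq_zero.1 h5 with h6 | h6
  · exact h6
  · exact absurd (by simpa using h6) hu

/-- An eigenvector near level `n` is mostly `e n`. -/
theorem IsEig.norm_tail_le (e : HilbertBasis ℕ ℂ H) {A : H →L[ℂ] H} {w : ℝ} (hw : w < 1 / 2)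
    (hA : ‖A‖ ≤ w) {lam : ℂ} {n : ℕ} (hl : ‖lam - (2 * n + 1)‖ ≤ w) {u : H}
    (h : IsEig e A lam u) (hu : inner ℂ (e n) u = 1) :
    3 / 2 * ‖u - e n‖ ≤ w * ‖u‖ := by
  have h1 := gap_mul_norm_le e hl (by linarith) (inner_sub_of_inner_eq_one e hu) (y := A u)
    fun m hm => by rw [inner_sub_right, inner_of_ne e hm, sub_zero, h m]
  have h2 := norm_apply_le_of_le hA u
  nlinarith [norm_nonneg (u - e n)]

theorem IsEig.norm_tail_le_half (e : HilbertBasis ℕ ℂ H) {A : H →L[ℂ] H} {w : ℝ} (hw : w < 1 / 2)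
    (hA : ‖A‖ ≤ w) {lam : ℂ} {n : ℕ} (hl : ‖lam - (2 * n + 1)‖ ≤ w) {u : H}
    (h : IsEig e A lam u) (hu : inner ℂ (e n) u = 1) :
    ‖u - e n‖ ≤ 1 / 2 ∧ ‖u‖ ≤ 3 / 2 := by
  have h1 := h.norm_tail_le e hw hA hl hu
  have h2 : ‖u‖ ≤ 1 + ‖u - e n‖ := by
    have := norm_add_le (e n) (u - e n)
    rwa [add_sub_cancel, e.orthonormal.1 n] at this
  have h3 : w * ‖u‖ ≤ 1 / 2 * ‖u‖ := by gcongr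
  constructor <;> linarith

theorem IsEig.inner_ne_zero (e : HilbertBasis ℕ ℂ H) {A : H →L[ℂ] H} {w : ℝ} (hw : w < 1 / 2)
    (hA : ‖A‖ ≤ w) {lam : ℂ} {n : ℕ} (hl : ‖lam - (2 * n + 1)‖ ≤ w) {u : H}
    (h : IsEig e A lam u) (hu : u ≠ 0) : inner ℂ (e n) u ≠ 0 := by
  intro h0
  have h1 := gap_mul_norm_le e hl (by linarith) h0 (y := A u) fun m _ => h m
  have h2 := norm_apply_le_of_le hA u
  nlinarith [norm_pos_iff.2 hu]

/-- Lipschitz dependence of eigenvectors and eigenvalues on the perturbation. -/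
theorem IsEig.lipschitz (e : HilbertBasis ℕ ℂ H) {A₀ A₁ : H →L[ℂ] H} {w : ℝ} (hw : w < 1 / 2)
    (hA₀ : ‖A₀‖ ≤ w) (hA₁ : ‖A₁‖ ≤ w) {lam₀ lam₁ : ℂ} {n : ℕ}
    (hl₀ : ‖lam₀ - (2 * n + 1)‖ ≤ w) (hl₁ : ‖lam₁ - (2 * n + 1)‖ ≤ w) {u₀ u₁ : H}
    (h₀ : IsEig e A₀ lam₀ u₀) (h₁ : IsEig e A₁ lam₁ u₁)
    (hu₀ : inner ℂ (e n) u₀ = 1) (hu₁ : inner ℂ (e n) u₁ = 1) :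
    ‖u₁ - u₀‖ ≤ 3 * ‖A₁ - A₀‖ ∧ ‖lam₁ - lam₀‖ ≤ 3 * ‖A₁ - A₀‖ := by
  obtain ⟨ht, hn⟩ := h₀.norm_tail_le_half e hw hA₀ hl₀ hu₀
  have hA : A₁ u₁ - A₀ u₀ = A₁ (u₁ - u₀) + (A₁ - A₀) u₀ := by
    simp [map_sub]
  have hAn : ‖A₁ u₁ - A₀ u₀‖ ≤ 1 / 2 * ‖u₁ - u₀‖ + ‖A₁ - A₀‖ * (3 / 2) := by
    rw [hA]
    refine (norm_add_le _ _).trans (add_le_add ?_ ?_)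
    · exact norm_apply_le_of_le (hA₁.trans hw.le) _
    · exact ((A₁ - A₀).le_opNorm u₀).trans (by gcongr)
  have hl : ‖lam₁ - lam₀‖ ≤ 1 / 2 * ‖u₁ - u₀‖ + ‖A₁ - A₀‖ * (3 / 2) := by
    have : lam₁ - lam₀ = inner ℂ (e n) (A₁ u₁ - A₀ u₀) := by
      rw [inner_sub_right, ← h₀ n, ← h₁ n, hu₀, hu₁]; ring
    rw [this]
    exact (norm_inner_basis_le e n _).trans hAn
  have hx : inner ℂ (e n) (u₁ - u₀) = 0 := by rw [inner_sub_right, hu₀, hu₁, sub_self]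
  have h1 := gap_mul_norm_le e hl₁ (by linarith) hx
    (y := (A₁ u₁ - A₀ u₀) - (lam₁ - lam₀) • (u₀ - e n)) fun m hm => by
      rw [inner_sub_right, inner_sub_right, inner_sub_right, inner_smul_right, inner_sub_right,
        inner_of_ne e hm, ← h₀ m, ← h₁ m]
      ring
  have h2 : ‖(A₁ u₁ - A₀ u₀) - (lam₁ - lam₀) • (u₀ - e n)‖ ≤
      (1 / 2 * ‖u₁ - u₀‖ + ‖A₁ - A₀‖ * (3 / 2)) +
        (1 / 2 * ‖u₁ - u₀‖ + ‖A₁ - A₀‖ * (3 / 2)) * (1 / 2) := by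
    refine (norm_sub_le _ _).trans (add_le_add hAn ?_)
    rw [norm_smul]
    gcongr
  have h3 : 3 / 2 * ‖u₁ - u₀‖ ≤ (2 - w) * ‖u₁ - u₀‖ := by gcongr; linarith
  constructor <;> linarith

theorem IsEig.unique (e : HilbertBasis ℕ ℂ H) {A : H →L[ℂ] H} {w : ℝ} (hw : w < 1 / 2)
    (hA : ‖A‖ ≤ w) {lam₀ lam₁ : ℂ} {n : ℕ}
    (hl₀ : ‖lam₀ - (2 * n + 1)‖ ≤ w) (hl₁ : ‖lam₁ - (2 * n + 1)‖ ≤ w) {u₀ u₁ : H}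
    (h₀ : IsEig e A lam₀ u₀) (h₁ : IsEig e A lam₁ u₁) (hu₀ : u₀ ≠ 0) (hu₁ : u₁ ≠ 0) :
    lam₁ = lam₀ := by
  have c₀ := h₀.inner_ne_zero e hw hA hl₀ hu₀
  have c₁ := h₁.inner_ne_zero e hw hA hl₁ hu₁
  have := ((h₀.smul (inner ℂ (e n) u₀)⁻¹).lipschitz e hw hA hA hl₀ hl₁
    (h₁.smul (inner ℂ (e n) u₁)⁻¹) (by rw [inner_smul_right, inv_mul_cancel₀ c₀])
    (by rw [inner_smul_right, inv_mul_cancel₀ c₁])).2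
  rw [sub_self, norm_zero, mul_zero] at this
  exact sub_eq_zero.1 (norm_le_zero_iff.1 this)

theorem exists_isEig_of_norm_lt [CompleteSpace H] (e : HilbertBasis ℕ ℂ H) {A : H →L[ℂ] H}
    {w : ℝ} (hw : w < 1 / 2) (hA : ‖A‖ ≤ w) (n : ℕ) :
    ∃ (lam : ℂ) (u : H), inner ℂ (e n) u = 1 ∧ ‖lam - (2 * n + 1)‖ ≤ 2 * w ∧ IsEig e A lam u := by
  have hw0 : 0 ≤ w := (norm_nonneg _).trans hA
  let s : Set H := {v | inner ℂ (e n) v = 0 ∧ ‖v‖ ≤ 1}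
  have hsc : IsComplete s := by
    refine IsClosed.isComplete ?_
    exact (isClosed_eq (by fun_prop) continuous_const).inter
      (isClosed_le continuous_norm continuous_const)
  let lam : H → ℂ := fun v => (2 * n + 1) + inner ℂ (e n) (A (e n + v))
  have hsub : ∀ v v', lam v - lam v' = inner ℂ (e n) (A (v - v')) := fun v v' => by
    simp only [lam, map_add, map_sub, inner_add_right, inner_sub_right]; ring
  have hnv : ∀ v ∈ s, ‖A (e n + v)‖ ≤ 2 * w := fun v hv => by
    have h1 := norm_apply_le_of_le hA (e n + v)
    have h2 := norm_add_le (e n) v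
    rw [e.orthonormal.1 n] at h2
    have h3 := hv.2
    nlinarith
  have hlam : ∀ v ∈ s, ‖lam v - (2 * n + 1)‖ ≤ 2 * w := fun v hv => by
    simp only [lam, add_sub_cancel_left]
    exact (norm_inner_basis_le e n _).trans (hnv v hv)
  have hex : ∀ v, v ∈ s → ∃ x : H, inner ℂ (e n) x = 0 ∧ ∀ m, m ≠ n →
      (lam v - (2 * m + 1)) * inner ℂ (e m) x = inner ℂ (e m) (A (e n + v)) := fun v hv =>
    exists_reduced_resolvent e (hlam v hv) (by linarith) _
  choose! T hT0 hT using hex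
  have hT1 : ∀ v ∈ s, ‖T v‖ ≤ 1 := fun v hv => by
    have h1 := gap_mul_norm_le e (hlam v hv) (by linarith) (hT0 v hv) (hT v hv)
    have h2 := hnv v hv
    nlinarith [norm_nonneg (T v)]
  have hmaps : MapsTo T s s := fun v hv => ⟨hT0 v hv, hT1 v hv⟩
  have hlip : ∀ v ∈ s, ∀ v' ∈ s, ‖T v - T v'‖ ≤ w / (1 - w) * ‖v - v'‖ := by
    intro v hv v' hv'
    have h0 : inner ℂ (e n) (T v - T v') = 0 := by
      rw [inner_sub_right, hT0 v hv, hT0 v' hv', sub_self]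
    have h1 := gap_mul_norm_le e (hlam v hv) (by linarith) h0
      (y := A (v - v') - (lam v - lam v') • T v') fun m hm => by
        have e1 := hT v hv m hm
        have e2 := hT v' hv' m hm
        simp only [inner_sub_right, inner_smul_right, map_sub, map_add, inner_add_right] at e1 e2 ⊢
        linear_combination e1 - e2
    have h2 : ‖A (v - v') - (lam v - lam v') • T v'‖ ≤ w * ‖v - v'‖ + w * ‖v - v'‖ * 1 := by
      refine (norm_sub_le _ _).trans (add_le_add (norm_apply_le_of_le hA _) ?_)
      rw [norm_smul]
      gcongr
      · rw [hsub]
        exact (norm_inner_basis_le e n _).trans (norm_apply_le_of_le hA _)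
      · exact hT1 v' hv'
    rw [div_mul_eq_mul_div, le_div_iff₀ (by linarith)]
    nlinarith
  have hK : ContractingWith (w / (1 - w)).toNNReal (hmaps.restrict T s s) := by
    refine ⟨?_, LipschitzWith.of_dist_le_mul fun x y => ?_⟩
    · rw [Real.toNNReal_lt_one, div_lt_one (by linarith)]
      linarith
    · rw [Real.coe_toNNReal _ (div_nonneg hw0 (by linarith)), Subtype.dist_eq,
        Subtype.dist_eq, dist_eq_norm, dist_eq_norm]
      exact hlip x x.2 y y.2
  obtain ⟨v, hv, hfix, -⟩ := hK.exists_fixedPoint' hsc hmaps (x := 0) ⟨by simp, by simp⟩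
    (edist_ne_top _ _)
  refine ⟨lam v, e n + v, ?_, hlam v hv, fun m => ?_⟩
  · rw [inner_add_right, hv.1, inner_basis_self, add_zero]
  · by_cases hm : m = n
    · subst hm
      rw [inner_add_right, hv.1, inner_basis_self]
      simp [lam]
    · have := hT v hv m hm
      rw [hfix.eq] at this
      rw [inner_add_right, inner_of_ne e hm, zero_add, this]

/-- Existence of a real eigenvalue near each level. -/
theorem exists_isEig [CompleteSpace H] (e : HilbertBasis ℕ ℂ H) {A : H →L[ℂ] H}
    (hs : (A : H →ₗ[ℂ] H).IsSymmetric) {w : ℝ} (hw : w < 1 / 2) (hA : ‖A‖ ≤ w) (n : ℕ) :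
    ∃ (lam : ℝ) (u : H), inner ℂ (e n) u = 1 ∧ ‖(lam : ℂ) - (2 * n + 1)‖ ≤ w ∧
      IsEig e A lam u := by
  obtain ⟨lam, u, hu, hl, h⟩ := exists_isEig_of_norm_lt e hw hA n
  have hu0 : u ≠ 0 := by rintro rfl; simp at hu
  have him : ((lam.re : ℝ) : ℂ) = lam :=
    Complex.ext (by simp) (by simp [h.im_eq_zero e hs hu0])
  refine ⟨lam.re, u, hu, ?_, by rwa [him]⟩
  rw [him]
  obtain ⟨m, hm⟩ := h.exists_near e hA hu0
  by_cases hmn : m = n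
  · rwa [hmn] at hm
  · linarith [gap_le_norm_sub hl hmn]

theorem IsEig.sub_mul_inner (e : HilbertBasis ℕ ℂ H) {A₀ A₁ : H →L[ℂ] H}
    (hs : (A₀ : H →ₗ[ℂ] H).IsSymmetric) {lam₀ lam₁ : ℝ} {u₀ u₁ : H}
    (h₀ : IsEig e A₀ lam₀ u₀) (h₁ : IsEig e A₁ lam₁ u₁) :
    ((lam₁ - lam₀ : ℝ) : ℂ) * inner ℂ u₀ u₁ = inner ℂ u₀ ((A₁ - A₀) u₁) := by
  have e1 := e.hasSum_inner_mul_inner u₀ (A₁ u₁)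
  have e0 := e.hasSum_inner_mul_inner (A₀ u₀) u₁
  have e2 := (e.hasSum_inner_mul_inner u₀ u₁).mul_left ((lam₁ - lam₀ : ℝ) : ℂ)
  have hs' : inner ℂ (A₀ u₀) u₁ = inner ℂ u₀ (A₀ u₁) := hs u₀ u₁
  rw [sub_apply, inner_sub_right, ← hs']
  refine e2.unique ((e1.sub e0).congr_fun fun m => ?_)
  rw [← h₁ m, ← inner_conj_symm (A₀ u₀) (e m), ← h₀ m, map_mul, inner_conj_symm,
    map_sub, map_add, map_mul, map_one, Complex.conj_ofReal, Complex.conj_natCast,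
    Complex.conj_ofNat]
  push_cast
  ring

/-- First-order perturbation theory (Feynman–Hellmann). -/
theorem hasDerivAt_of_isEig (e : HilbertBasis ℕ ℂ H) {A : ℝ → H →L[ℂ] H} {A' : H →L[ℂ] H}
    (hs : ∀ t, (A t : H →ₗ[ℂ] H).IsSymmetric) {w : ℝ} (hw : w < 1 / 2) (hA : ∀ t, ‖A t‖ ≤ w)
    {n : ℕ} {lam : ℝ → ℝ} {u : ℝ → H} (hl : ∀ t, ‖(lam t : ℂ) - (2 * n + 1)‖ ≤ w)
    (h : ∀ t, IsEig e (A t) (lam t) (u t)) (hu : ∀ t, inner ℂ (e n) (u t) = 1) {k : ℝ}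
    (hd : HasDerivAt A A' k) :
    HasDerivAt lam ((inner ℂ (u k) (A' (u k)) / inner ℂ (u k) (u k)).re) k := by
  have hu0 : u k ≠ 0 := by intro h0; simpa [h0] using hu k
  have hcu : Tendsto u (𝓝[≠] k) (𝓝 (u k)) := by
    refine Tendsto.mono_left ?_ nhdsWithin_le_nhds
    rw [tendsto_iff_norm_sub_tendsto_zero]
    refine squeeze_zero (fun _ => norm_nonneg _) (fun t =>
      ((h k).lipschitz e hw (hA k) (hA t) (hl k) (hl t) (h t) (hu k) (hu t)).1) ?_
    have := (tendsto_iff_norm_sub_tendsto_zero.1 hd.continuousAt.tendsto).const_mul 3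
    simpa using this
  have hin : Tendsto (fun t => inner ℂ (u k) (u t)) (𝓝[≠] k) (𝓝 (inner ℂ (u k) (u k))) :=
    tendsto_const_nhds.inner hcu
  have hne : inner ℂ (u k) (u k) ≠ 0 := inner_self_ne_zero.2 hu0
  rw [hasDerivAt_iff_tendsto_slope] at hd ⊢
  have happ {v : ℝ → H} (hv : Tendsto v (𝓝[≠] k) (𝓝 (u k))) :
      Tendsto (fun t => slope A k t (v t)) (𝓝[≠] k) (𝓝 (A' (u k))) :=
    (isBoundedBilinearMap_apply.continuous.tendsto (A', u k)).comp (hd.prodMk_nhds hv)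
  have hA2 : Tendsto (fun t => inner ℂ (u k) (slope A k t (u t)) / inner ℂ (u k) (u t)) (𝓝[≠] k)
      (𝓝 (inner ℂ (u k) (A' (u k)) / inner ℂ (u k) (u k))) :=
    (tendsto_const_nhds.inner (happ hcu)).div hin hne
  refine ((Complex.continuous_re.tendsto _).comp hA2).congr' ?_
  filter_upwards [hin.eventually_ne hne] with t ht
  have h1 := (h k).sub_mul_inner e (hs k) (h t)
  have h2 : inner ℂ (u k) (slope A k t (u t)) =
      ((slope lam k t : ℝ) : ℂ) * inner ℂ (u k) (u t) := by
    rw [slope_def_module, slope_def_module, smul_apply]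
    rw [← Complex.coe_smul, inner_smul_right, ← h1]
    push_cast
    simp
    ring
  simp [h2, ht]

theorem IsEig.expectation_sub_le (e : HilbertBasis ℕ ℂ H) {A : H →L[ℂ] H} {w : ℝ}
    (hw : w < 1 / 2) (hA : ‖A‖ ≤ w) {lam : ℂ} {n : ℕ} (hl : ‖lam - (2 * n + 1)‖ ≤ w) {u : H}
    (h : IsEig e A lam u) (hu : inner ℂ (e n) u = 1) (B : H →L[ℂ] H) :
    ‖inner ℂ u (B u) / inner ℂ u u - inner ℂ (e n) (B (e n))‖ ≤ 2 * w * ‖B‖ := by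
  have hu0 : u ≠ 0 := by rintro rfl; simp at hu
  have ht := h.norm_tail_le e hw hA hl hu
  set v := u - e n with hv
  have huv : u = e n + v := by rw [hv]; abel
  have hev : inner ℂ (e n) v = 0 := inner_sub_of_inner_eq_one e hu
  have hve : inner ℂ v (e n) = 0 := by rw [← inner_conj_symm, hev, map_zero]
  have hn : ‖u‖ ^ 2 = 1 + ‖v‖ ^ 2 := by
    have := norm_add_sq_eq_norm_sq_add_norm_sq_of_inner_eq_zero (𝕜 := ℂ) (e n) v hev
    rw [← huv, e.orthonormal.1 n] at this
    nlinarith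
  have huu : inner ℂ u u = ((1 + ‖v‖ ^ 2 : ℝ) : ℂ) := by
    rw [inner_self_eq_norm_sq_to_K, ← hn]; norm_cast
  have hpos : 0 < 1 + ‖v‖ ^ 2 := by positivity
  have hb : ∀ x y : H, ‖inner ℂ x (B y)‖ ≤ ‖B‖ * (‖x‖ * ‖y‖) := fun x y =>
    (norm_inner_le_norm x (B y)).trans (by
      have := B.le_opNorm y
      nlinarith [norm_nonneg x])
  have h1 := hb (e n) (e n)
  have h2 := hb (e n) v
  have h3 := hb v (e n)
  have h4 := hb v v
  rw [e.orthonormal.1 n] at h1 h2 h3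
  have key : inner ℂ u (B u) / inner ℂ u u - inner ℂ (e n) (B (e n)) =
      (inner ℂ (e n) (B v) + inner ℂ v (B (e n)) + inner ℂ v (B v) -
        ((‖v‖ ^ 2 : ℝ) : ℂ) * inner ℂ (e n) (B (e n))) / ((1 + ‖v‖ ^ 2 : ℝ) : ℂ) := by
    have hne : ((1 + ‖v‖ ^ 2 : ℝ) : ℂ) ≠ 0 := by exact_mod_cast hpos.ne'
    rw [huu, eq_div_iff hne, sub_mul, div_mul_cancel₀ _ hne, huv]
    simp only [map_add, inner_add_left, inner_add_right]
    push_cast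
    ring
  rw [key, norm_div, Complex.norm_real, Real.norm_of_nonneg hpos.le, div_le_iff₀ hpos]
  have h5 : ‖((‖v‖ ^ 2 : ℝ) : ℂ) * inner ℂ (e n) (B (e n))‖ ≤ ‖v‖ ^ 2 * ‖B‖ := by
    rw [norm_mul, Complex.norm_real, Real.norm_of_nonneg (by positivity)]
    gcongr
    linarith
  have h6 : ‖inner ℂ (e n) (B v) + inner ℂ v (B (e n)) + inner ℂ v (B v) -
        ((‖v‖ ^ 2 : ℝ) : ℂ) * inner ℂ (e n) (B (e n))‖ ≤ ‖B‖ * (2 * ‖v‖ * (1 + ‖v‖)) := by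
    refine (norm_sub_le _ _).trans ?_
    have := norm_add₃_le (a := inner ℂ (e n) (B v)) (b := inner ℂ v (B (e n)))
      (c := inner ℂ v (B v))
    nlinarith
  have h7 : 2 * ‖v‖ * (1 + ‖v‖) ≤ 2 * w * (1 + ‖v‖ ^ 2) := by
    have hw0 : 0 ≤ w := (norm_nonneg _).trans hA
    have h8 : 2 / 3 * (1 + ‖v‖) ≤ ‖u‖ := by
      refine abs_le_of_sq_le_sq' ?_ (norm_nonneg _) |>.2
      rw [hn]
      nlinarith [sq_nonneg (‖v‖ - 1), norm_nonneg v]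
    rw [← hn]
    nlinarith [norm_nonneg v, norm_nonneg u,
      mul_le_mul_of_nonneg_left h8 (mul_nonneg hw0 (norm_nonneg u))]
  calc _ ≤ _ := h6
    _ ≤ ‖B‖ * (2 * w * (1 + ‖v‖ ^ 2)) := by gcongr
    _ = _ := by ring

end Perturbation

section Multiplication

open Filter Topology

/-- Bounded continuous real functions on the line. -/
def IsBddCont (V : ℝ → ℝ) : Prop := Continuous V ∧ ∃ C : ℝ, ∀ x, |V x| ≤ C

theorem IsBddCont.memLp_mul {V : ℝ → ℝ} (hV : IsBddCont V) {f : ℝ → ℂ}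
    (hf : MemLp f 2 (volume : Measure ℝ)) :
    MemLp (fun x => (V x : ℂ) * f x) 2 (volume : Measure ℝ) := by
  obtain ⟨hc, C, hC⟩ := hV
  refine hf.of_le_mul (c := C)
    ((Complex.continuous_ofReal.comp hc).aestronglyMeasurable.mul hf.1) (ae_of_all _ fun x => ?_)
  rw [norm_mul, Complex.norm_real, Real.norm_eq_abs]
  gcongr
  exact hC x

theorem IsBddCont.sub {V U : ℝ → ℝ} (hV : IsBddCont V) (hU : IsBddCont U) :
    IsBddCont (fun x => V x - U x) := by
  obtain ⟨hc, C, hC⟩ := hV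
  obtain ⟨hc', C', hC'⟩ := hU
  exact ⟨hc.sub hc', C + C', fun x => (abs_sub _ _).trans (add_le_add (hC x) (hC' x))⟩

theorem IsBddCont.const_mul {V : ℝ → ℝ} (hV : IsBddCont V) (c : ℝ) :
    IsBddCont (fun x => c * V x) := by
  obtain ⟨hc, C, hC⟩ := hV
  refine ⟨hc.const_mul c, |c| * C, fun x => ?_⟩
  rw [abs_mul]
  gcongr
  exact hC x

theorem IsBddCont.comp_continuous {V : ℝ → ℝ} (hV : IsBddCont V) {g : ℝ → ℝ} (hg : Continuous g) :
    IsBddCont (fun x => V (g x)) :=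
  ⟨hV.1.comp hg, hV.2.imp fun _ hC _ => hC _⟩

/-- Multiplication by `V` as a linear map of `L²(ℝ)`. -/
noncomputable def mulLin {V : ℝ → ℝ} (hV : IsBddCont V) : L2R →ₗ[ℂ] L2R where
  toFun u := (hV.memLp_mul (Lp.memLp u)).toLp _
  map_add' u v := by
    refine Lp.ext ?_
    filter_upwards [(hV.memLp_mul (Lp.memLp (u + v))).coeFn_toLp,
      (hV.memLp_mul (Lp.memLp u)).coeFn_toLp, (hV.memLp_mul (Lp.memLp v)).coeFn_toLp,
      Lp.coeFn_add u v, Lp.coeFn_add ((hV.memLp_mul (Lp.memLp u)).toLp _)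
        ((hV.memLp_mul (Lp.memLp v)).toLp _)] with x h1 h2 h3 h4 h5
    rw [h1, h5, Pi.add_apply, h2, h3, h4, Pi.add_apply, mul_add]
  map_smul' c u := by
    refine Lp.ext ?_
    filter_upwards [(hV.memLp_mul (Lp.memLp (c • u))).coeFn_toLp,
      (hV.memLp_mul (Lp.memLp u)).coeFn_toLp, Lp.coeFn_smul c u,
      Lp.coeFn_smul c ((hV.memLp_mul (Lp.memLp u)).toLp _)] with x h1 h2 h3 h4
    rw [h1, RingHom.id_apply, h4, Pi.smul_apply, h2, h3, Pi.smul_apply, smul_eq_mul, smul_eq_mul]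
    ring

theorem coeFn_mulLin {V : ℝ → ℝ} (hV : IsBddCont V) (u : L2R) :
    mulLin hV u =ᵐ[volume] fun x => (V x : ℂ) * u x :=
  (hV.memLp_mul (Lp.memLp u)).coeFn_toLp

theorem norm_mulLin_le {V : ℝ → ℝ} (hV : IsBddCont V) {C : ℝ} (hC : ∀ x, |V x| ≤ C) (u : L2R) :
    ‖mulLin hV u‖ ≤ C * ‖u‖ := by
  refine Lp.norm_le_mul_norm_of_ae_le_mul ?_
  filter_upwards [coeFn_mulLin hV u] with x hx
  rw [hx, norm_mul, Complex.norm_real, Real.norm_eq_abs]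
  gcongr
  exact hC x

/-- Multiplication by a bounded continuous `V` as a bounded operator of `L²(ℝ)`. -/
noncomputable def mulOp (V : ℝ → ℝ) : L2R →L[ℂ] L2R := by
  classical
  exact if hV : IsBddCont V then (mulLin hV).mkContinuous hV.2.choose
    (norm_mulLin_le hV hV.2.choose_spec) else 0

theorem mulOp_apply {V : ℝ → ℝ} (hV : IsBddCont V) (u : L2R) : mulOp V u = mulLin hV u := by
  simp [mulOp, hV]

theorem coeFn_mulOp {V : ℝ → ℝ} (hV : IsBddCont V) (u : L2R) :
    mulOp V u =ᵐ[volume] fun x => (V x : ℂ) * u x := by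
  rw [mulOp_apply hV]
  exact coeFn_mulLin hV u

theorem norm_mulOp_le {V : ℝ → ℝ} (hV : IsBddCont V) {C : ℝ} (hC : ∀ x, |V x| ≤ C) :
    ‖mulOp V‖ ≤ C := by
  refine ContinuousLinearMap.opNorm_le_bound _ ((abs_nonneg _).trans (hC 0)) fun u => ?_
  rw [mulOp_apply hV]
  exact norm_mulLin_le hV hC u

theorem isSymmetric_mulOp {V : ℝ → ℝ} (hV : IsBddCont V) :
    (mulOp V : L2R →ₗ[ℂ] L2R).IsSymmetric := by
  intro u v
  change inner ℂ (mulOp V u) v = inner ℂ u (mulOp V v)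
  rw [L2.inner_def, L2.inner_def]
  refine integral_congr_ae ?_
  filter_upwards [coeFn_mulOp hV u, coeFn_mulOp hV v] with x h1 h2
  rw [h1, h2]
  simp
  ring

theorem mulOp_sub {V U : ℝ → ℝ} (hV : IsBddCont V) (hU : IsBddCont U) :
    mulOp V - mulOp U = mulOp (fun x => V x - U x) := by
  ext1 u
  rw [sub_apply]
  refine Lp.ext ?_
  filter_upwards [coeFn_mulOp hV u, coeFn_mulOp hU u, coeFn_mulOp (hV.sub hU) u,
    Lp.coeFn_sub (mulOp V u) (mulOp U u)] with x h1 h2 h3 h4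
  rw [h4, Pi.sub_apply, h1, h2, h3]
  push_cast
  ring

theorem smul_mulOp {V : ℝ → ℝ} (hV : IsBddCont V) (c : ℝ) :
    c • mulOp V = mulOp (fun x => c * V x) := by
  ext1 u
  rw [smul_apply]
  refine Lp.ext ?_
  filter_upwards [coeFn_mulOp hV u, coeFn_mulOp (hV.const_mul c) u,
    Lp.coeFn_smul c (mulOp V u)] with x h1 h2 h3
  rw [h3, Pi.smul_apply, h1, h2]
  simp [mul_assoc]

theorem abs_sub_le_of_abs_deriv_le {f : ℝ → ℝ} (hf : Differentiable ℝ f) {C : ℝ}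
    (hC : ∀ x, |deriv f x| ≤ C) (x y : ℝ) : |f y - f x| ≤ C * |y - x| :=
  convex_univ.norm_image_sub_le_of_norm_deriv_le (𝕜 := ℝ) (fun x _ => hf x) (fun x _ => hC x)
    (mem_univ x) (mem_univ y)

theorem abs_taylor_one_le {W : ℝ → ℝ} (hW : Differentiable ℝ W) (hW' : Differentiable ℝ (deriv W))
    {C : ℝ} (hC : ∀ x, |deriv (deriv W) x| ≤ C) (x h : ℝ) :
    |W (x + h) - W x - h * deriv W x| ≤ C * h ^ 2 := by
  have hC0 : 0 ≤ C := (abs_nonneg _).trans (hC 0)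
  have hd : ∀ s, HasDerivAt (fun s => W s - deriv W x * s) (deriv W s - deriv W x) s := fun s => by
    simpa using! (hW s).hasDerivAt.sub ((hasDerivAt_id s).const_mul (deriv W x))
  have := (convex_uIcc x (x + h)).norm_image_sub_le_of_norm_hasDerivWithin_le (C := C * |h|)
    (fun s _ => (hd s).hasDerivWithinAt) (fun s hs => by
      refine (abs_sub_le_of_abs_deriv_le hW' hC x s).trans ?_
      exact mul_le_mul_of_nonneg_left (by simpa using abs_sub_left_of_mem_uIcc hs) hC0)
    left_mem_uIcc right_mem_uIcc
  rw [Real.norm_eq_abs, Real.norm_eq_abs, add_sub_cancel_left, mul_assoc, ← abs_mul,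
    abs_mul_self] at this
  convert this using 2 <;> ring

theorem hasDerivAt_mulOp_translate {W : ℝ → ℝ} (hW : ContDiff ℝ 2 W)
    (hW0 : ∃ C : ℝ, ∀ x, |W x| ≤ C) (hW1 : ∃ C : ℝ, ∀ x, |deriv W x| ≤ C)
    (hW2 : ∃ C : ℝ, ∀ x, |deriv (deriv W) x| ≤ C) (a b k : ℝ) :
    HasDerivAt (fun t => mulOp fun y => b⁻¹ * W (a * y + t / b))
      (mulOp fun y => b⁻¹ * b⁻¹ * deriv W (a * y + k / b)) k := by
  have hd := hW.differentiable (by simp)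
  have hc1 : ContDiff ℝ 1 (deriv W) :=
    ((contDiff_succ_iff_deriv (n := 1)).1 (by rw [one_add_one_eq_two]; exact hW)).2.2
  have hd1 := hc1.differentiable (by simp)
  obtain ⟨C, hC⟩ := hW2
  have hB : ∀ t, IsBddCont fun y => b⁻¹ * W (a * y + t / b) := fun t =>
    (IsBddCont.comp_continuous ⟨hW.continuous, hW0⟩ (g := fun y => a * y + t / b)
      (by fun_prop)).const_mul _
  have hB' : IsBddCont fun y => b⁻¹ * b⁻¹ * deriv W (a * y + k / b) :=
    (IsBddCont.comp_continuous ⟨hc1.continuous, hW1⟩ (g := fun y => a * y + k / b)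
      (by fun_prop)).const_mul _
  rw [hasDerivAt_iff_isLittleO]
  have hO : (fun t => (mulOp fun y => b⁻¹ * W (a * y + t / b)) -
      (mulOp fun y => b⁻¹ * W (a * y + k / b)) -
      (t - k) • mulOp fun y => b⁻¹ * b⁻¹ * deriv W (a * y + k / b)) =O[𝓝 k]
      fun t => (t - k) ^ 2 := by
    refine Asymptotics.IsBigO.of_bound (|b⁻¹| * (C * b⁻¹ ^ 2)) (Eventually.of_forall fun t => ?_)
    rw [smul_mulOp hB', mulOp_sub (hB t) (hB k), mulOp_sub ((hB t).sub (hB k)) (hB'.const_mul _)]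
    refine norm_mulOp_le (((hB t).sub (hB k)).sub (hB'.const_mul _)) fun y => ?_
    have h1 := abs_taylor_one_le hd hd1 hC (a * y + k / b) ((t - k) / b)
    have h2 : a * y + k / b + (t - k) / b = a * y + t / b := by ring
    rw [h2] at h1
    have h3 : b⁻¹ * W (a * y + t / b) - b⁻¹ * W (a * y + k / b) -
        (t - k) * (b⁻¹ * b⁻¹ * deriv W (a * y + k / b)) =
        b⁻¹ * (W (a * y + t / b) - W (a * y + k / b) - (t - k) / b * deriv W (a * y + k / b)) := by
      ring
    rw [h3, abs_mul, Real.norm_of_nonneg (by positivity)]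
    calc _ ≤ |b⁻¹| * (C * ((t - k) / b) ^ 2) := by gcongr
      _ = _ := by ring
  refine hO.trans_isLittleO ?_
  have := Asymptotics.isLittleO_pow_sub_sub (E' := ℝ) k (m := 2) (by norm_num)
  simpa [Asymptotics.isLittleO_norm_left] using this

end Multiplication

section Hermite

open Polynomial Filter Topology

/-- The product of the polynomial `q` with the Gaussian `exp(-y²/2)`. -/
noncomputable def polyGauss (q : ℝ[X]) (y : ℝ) : ℝ := q.eval y * Real.exp (-y ^ 2 / 2)

theorem hasDerivAt_polyGauss (q : ℝ[X]) (y : ℝ) :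
    HasDerivAt (polyGauss q) (polyGauss (derivative q - X * q) y) y := by
  have h1 : HasDerivAt (fun y : ℝ => -y ^ 2 / 2) (-y) y := by
    have := ((hasDerivAt_pow 2 y).neg).div_const 2
    refine this.congr_deriv ?_
    simp
    ring
  refine ((q.hasDerivAt y).mul h1.exp).congr_deriv ?_
  simp only [polyGauss, eval_sub, eval_mul, eval_X]
  ring

theorem contDiff_polyGauss (q : ℝ[X]) : ContDiff ℝ ∞ (polyGauss q) := by
  have h : ContDiff ℝ ∞ fun y => q.eval y := by simpa using q.contDiff_aeval (𝕜 := ℝ) ∞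
  exact h.mul (by fun_prop)

theorem X_mul_polyGauss (q : ℝ[X]) (y : ℝ) : y * polyGauss q y = polyGauss (X * q) y := by
  simp [polyGauss, mul_assoc]

theorem integrable_eval_mul_exp (q : ℝ[X]) {c : ℝ} (hc : 0 < c) :
    Integrable (fun y : ℝ => q.eval y * Real.exp (-c * y ^ 2)) := by
  induction q using Polynomial.induction_on' with
  | add p q hp hq => simpa [add_mul] using! hp.add hq
  | monomial n a =>
    have := (integrable_rpow_mul_exp_neg_mul_sq hc (s := n)
      (by have := n.cast_nonneg (α := ℝ); linarith)).const_mul a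
    simpa [mul_assoc] using this

theorem memLp_polyGauss (q : ℝ[X]) : MemLp (polyGauss q) 2 (volume : Measure ℝ) := by
  rw [memLp_two_iff_integrable_sq (contDiff_polyGauss q).continuous.aestronglyMeasurable]
  convert! integrable_eval_mul_exp (q ^ 2) one_pos using 2 with y
  rw [polyGauss, mul_pow, eval_pow, ← Real.exp_nat_mul]
  congr 2
  push_cast
  ring

theorem derivative_hermite_succ (n : ℕ) :
    derivative (hermite (n + 1)) = ((n + 1 : ℕ) : ℤ[X]) * hermite n := by
  induction n with
  | zero => simp [hermite_succ]
  | succ n ih =>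
    rw [hermite_succ (n + 1), derivative_sub, derivative_mul, ih, derivative_mul, hermite_succ n]
    simp
    ring

theorem hermite_ode (n : ℕ) :
    derivative (derivative (hermite n)) = X * derivative (hermite n) - (n : ℤ[X]) * hermite n := by
  have h := congrArg derivative (hermite_succ n)
  rw [derivative_hermite_succ, derivative_sub, derivative_mul, derivative_X] at h
  push_cast at h
  linear_combination h

/-- The real polynomial `He_n(√2 y)`. -/
noncomputable def scaledHermite (n : ℕ) : ℝ[X] :=
  ((hermite n).map (Int.castRingHom ℝ)).comp (C √2 * X)

theorem hermiteAux_eq (n : ℕ) : hermiteAux n = polyGauss (scaledHermite n) := by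
  funext y
  simp [hermiteAux, polyGauss, scaledHermite, aeval_def, eval_map]

theorem scaledHermite_ode (n : ℕ) :
    derivative (derivative (scaledHermite n)) =
      2 * X * derivative (scaledHermite n) - 2 * (n : ℝ[X]) * scaledHermite n := by
  have h := congrArg (fun p : ℤ[X] => (p.map (Int.castRingHom ℝ)).comp (C √2 * X)) (hermite_ode n)
  simp only [Polynomial.map_sub, Polynomial.map_mul, map_X, Polynomial.map_natCast, sub_comp,
    mul_comp, X_comp, natCast_comp] at h
  have h2 : (C √2 : ℝ[X]) * C √2 = 2 := by
    rw [← C_mul, Real.mul_self_sqrt (by norm_num)]; rfl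
  simp only [scaledHermite, derivative_comp, derivative_mul, derivative_C, derivative_X, zero_mul,
    zero_add, mul_one, derivative_map] at h ⊢
  linear_combination (C √2 * C √2) * h +
    (C √2 * X * ((derivative (hermite n)).map (Int.castRingHom ℝ)).comp (C √2 * X) -
      n * ((hermite n).map (Int.castRingHom ℝ)).comp (C √2 * X)) * h2

theorem degree_scaledHermite (n : ℕ) : (scaledHermite n).degree = n := by
  have hX : (C √2 * X : ℝ[X]).natDegree = 1 := natDegree_C_mul_X _ (by simp)
  have hm : ((hermite n).map (Int.castRingHom ℝ)).Monic := (hermite_monic n).map _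
  have hn : (scaledHermite n).natDegree = n := by
    rw [scaledHermite, natDegree_comp, hX, mul_one, (hermite_monic n).natDegree_map,
      natDegree_hermite]
  have h0 : scaledHermite n ≠ 0 := by
    rw [← leadingCoeff_ne_zero, scaledHermite, leadingCoeff_comp (by simp [hX]), hm.leadingCoeff]
    simp
  rw [degree_eq_natDegree h0, hn]

theorem integral_mul_polyGauss_eq_zero {f : ℝ → ℝ} (hf : MemLp f 2 (volume : Measure ℝ))
    (h : ∀ n, ∫ y, f y * polyGauss (scaledHermite n) y = 0) (q : ℝ[X]) :
    ∫ y, f y * polyGauss q y = 0 := by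
  have hi : ∀ q, Integrable fun y => f y * polyGauss q y := fun q =>
    hf.integrable_mul (memLp_polyGauss q)
  let L : ℝ[X] →ₗ[ℝ] ℝ :=
    { toFun := fun q => ∫ y, f y * polyGauss q y
      map_add' := fun p q => by
        rw [← integral_add (hi p) (hi q)]
        refine integral_congr_ae (ae_of_all _ fun y => ?_)
        simp only [polyGauss, eval_add]
        ring
      map_smul' := fun c q => by
        rw [RingHom.id_apply, smul_eq_mul, ← integral_const_mul]
        refine integral_congr_ae (ae_of_all _ fun y => ?_)
        simp only [polyGauss, eval_smul, smul_eq_mul]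
        ring }
  let S : Polynomial.Sequence ℝ := ⟨scaledHermite, degree_scaledHermite⟩
  have hS : Submodule.span ℝ (Set.range scaledHermite) = ⊤ := S.span fun i =>
    (leadingCoeff_ne_zero.2 (S.ne_zero i)).isUnit
  have hle : Submodule.span ℝ (Set.range scaledHermite) ≤ LinearMap.ker L :=
    Submodule.span_le.2 (by rintro _ ⟨n, rfl⟩; exact h n)
  exact hle (hS ▸ Submodule.mem_top : q ∈ _)

/-- A real integrable function is determined by its Fourier transform. -/
theorem ae_eq_zero_of_integral_mul_cexp_eq_zero {g : ℝ → ℝ} (hg : Integrable g)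
    (h : ∀ t : ℝ, ∫ y : ℝ, (g y : ℂ) * Complex.exp (t * y * Complex.I) = 0) :
    g =ᵐ[volume] 0 := by
  have hneg : Integrable (fun y => -g y) := hg.neg
  have : IsFiniteMeasure (volume.withDensity fun y => ENNReal.ofReal (g y)) :=
    isFiniteMeasure_withDensity_ofReal hg.2
  have : IsFiniteMeasure (volume.withDensity fun y => ENNReal.ofReal (-g y)) :=
    isFiniteMeasure_withDensity_ofReal hneg.2
  have hm : AEMeasurable (fun y => ENNReal.ofReal (g y)) := hg.1.aemeasurable.ennreal_ofReal
  have hm' : AEMeasurable (fun y => ENNReal.ofReal (-g y)) := hneg.1.aemeasurable.ennreal_ofReal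
  have hce : ∀ t : ℝ, Continuous fun y : ℝ => Complex.exp (t * y * Complex.I) := fun t => by
    fun_prop
  have hi : ∀ {f : ℝ → ℝ}, Integrable f → ∀ t : ℝ, Integrable fun y : ℝ =>
      (ENNReal.ofReal (f y)).toReal • Complex.exp (t * y * Complex.I) := fun {f} hf t => by
    refine hf.mono (hf.1.aemeasurable.ennreal_ofReal.ennreal_toReal.aestronglyMeasurable.smul
      (hce t).aestronglyMeasurable) (ae_of_all _ fun y => ?_)
    rw [norm_smul, ← Complex.ofReal_mul, Complex.norm_exp_ofReal_mul_I, mul_one,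
      ENNReal.toReal_ofReal', Real.norm_of_nonneg (le_max_right _ _)]
    exact max_le (le_abs_self _) (abs_nonneg _)
  have heq : (volume.withDensity fun y => ENNReal.ofReal (g y)) =
      volume.withDensity fun y => ENNReal.ofReal (-g y) := by
    refine Measure.ext_of_charFun (funext fun t => ?_)
    rw [charFun_apply_real, charFun_apply_real,
      integral_withDensity_eq_integral_toReal_smul₀ hm (ae_of_all _ fun _ => ENNReal.ofReal_lt_top),
      integral_withDensity_eq_integral_toReal_smul₀ hm'
        (ae_of_all _ fun _ => ENNReal.ofReal_lt_top),
      ← sub_eq_zero, ← integral_sub (hi hg t) (hi hneg t), ← h t]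
    refine integral_congr_ae (ae_of_all _ fun y => ?_)
    simp only [ENNReal.toReal_ofReal']
    rw [← sub_smul, Complex.real_smul, max_zero_sub_max_neg_zero_eq_self (g y)]
  have hae := (withDensity_eq_iff hm hm' (by
    rw [← lt_top_iff_ne_top]
    exact lt_of_le_of_lt (lintegral_ofReal_le_lintegral_enorm g) hg.2)).1 heq
  filter_upwards [hae] with y hy
  rcases le_total (g y) 0 with h0 | h0
  · rw [ENNReal.ofReal_of_nonpos h0, eq_comm, ENNReal.ofReal_eq_zero] at hy
    exact le_antisymm h0 (by simpa using hy)
  · rw [ENNReal.ofReal_of_nonpos (neg_nonpos.2 h0), ENNReal.ofReal_eq_zero] at hy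
    exact le_antisymm hy h0

/-- The functions `p(y) exp(-y²/2)`, `p` polynomial, are total in `L²(ℝ)`. -/
theorem ae_eq_zero_of_integral_mul_polyGauss_eq_zero {f : ℝ → ℝ}
    (hf : MemLp f 2 (volume : Measure ℝ)) (h : ∀ q, ∫ y, f y * polyGauss q y = 0) :
    f =ᵐ[volume] 0 := by
  have hexp : ∀ t : ℝ, MemLp (fun y : ℝ => Real.exp (|t * y|) * Real.exp (-y ^ 2 / 2)) 2 := by
    intro t
    rw [memLp_two_iff_integrable_sq (by fun_prop)]
    have hi := (integrable_exp_neg_mul_sq (b := 1 / 2) (by norm_num)).const_mul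
      (Real.exp (2 * t ^ 2))
    refine hi.mono' (by fun_prop) (ae_of_all _ fun y => ?_)
    rw [Real.norm_of_nonneg (by positivity), ← Real.exp_add, ← Real.exp_add, ← Real.exp_nat_mul]
    refine Real.exp_le_exp.2 ?_
    push_cast
    rw [abs_mul, ← sq_abs t, ← sq_abs y]
    nlinarith [sq_nonneg (2 * |t| - |y|)]
  have hG : ∀ y : ℝ, polyGauss 1 y = Real.exp (-y ^ 2 / 2) := fun y => by simp [polyGauss]
  have hg : Integrable fun y => f y * polyGauss 1 y := hf.integrable_mul (memLp_polyGauss 1)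
  have h0 : (fun y => f y * polyGauss 1 y) =ᵐ[volume] 0 := by
    refine ae_eq_zero_of_integral_mul_cexp_eq_zero hg fun t => ?_
    let F : ℕ → ℝ → ℂ := fun n y =>
      ((f y * polyGauss 1 y : ℝ) : ℂ) * ((t * y * Complex.I) ^ n / (n.factorial : ℂ))
    let bound : ℕ → ℝ → ℝ := fun n y => |f y * polyGauss 1 y| * (|t * y| ^ n / n.factorial)
    have hb : ∀ y, HasSum (fun n => bound n y) (|f y * polyGauss 1 y| * Real.exp |t * y|) :=
      fun y => by
        rw [Real.exp_eq_exp_ℝ]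
        exact (NormedSpace.expSeries_div_hasSum_exp (|t * y|)).mul_left _
    have hF : ∀ n, ∫ y, F n y = 0 := fun n => by
      have h1 : F n = fun y => ((f y * polyGauss (X ^ n) y : ℝ) : ℂ) *
          ((t * Complex.I) ^ n / (n.factorial : ℂ)) := by
        funext y
        simp only [F, polyGauss, eval_one, eval_pow, eval_X]
        push_cast
        ring
      rw [h1, integral_mul_const, integral_complex_ofReal, h]
      simp
    have hsum := hasSum_integral_of_dominated_convergence (μ := volume) (F := F)
      (f := fun y => ((f y * polyGauss 1 y : ℝ) : ℂ) * Complex.exp (t * y * Complex.I)) bound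
      (fun n => by
        refine (Complex.continuous_ofReal.comp_aestronglyMeasurable hg.1).mul ?_
        exact Continuous.aestronglyMeasurable (by fun_prop))
      (fun n => ae_of_all _ fun y => by
        simp only [F, bound, norm_mul, norm_div, norm_pow, Complex.norm_real, Complex.norm_I,
          Complex.norm_natCast, mul_one, abs_mul, Real.norm_eq_abs]
        exact le_rfl)
      (ae_of_all _ fun y => (hb y).summable)
      (by
        simp only [fun y => (hb y).tsum_eq]
        have := (hf.integrable_mul (hexp t)).abs
        refine this.congr (ae_of_all _ fun y => ?_)
        simp only [Pi.mul_apply, hG, abs_mul, Real.abs_exp]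
        ring)
      (ae_of_all _ fun y => by
        rw [Complex.exp_eq_exp_ℂ]
        exact (NormedSpace.expSeries_div_hasSum_exp (t * y * Complex.I)).mul_left _)
    simp only [hF] at hsum
    exact hsum.unique hasSum_zero
  filter_upwards [h0] with y hy
  rcases mul_eq_zero.1 hy with h1 | h1
  · exact h1
  · rw [hG] at h1
    exact absurd h1 (Real.exp_pos _).ne'

end Hermite

section Oscillator

open Polynomial Filter Topology

theorem norm_sq_eq_integral (u : L2R) : ‖u‖ ^ 2 = ∫ x, ‖u x‖ ^ 2 := by
  have h : ((‖u‖ ^ 2 : ℝ) : ℂ) = inner ℂ u u := by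
    rw [inner_self_eq_norm_sq_to_K]; norm_cast
  rw [L2.inner_def] at h
  have h2 : ∀ x, inner ℂ (u x) (u x) = ((‖u x‖ ^ 2 : ℝ) : ℂ) := fun x => by
    rw [inner_self_eq_norm_sq_to_K]; norm_cast
  simp only [h2, integral_complex_ofReal] at h
  exact_mod_cast h

theorem tendsto_L2R_of_dominated {u : ℕ → L2R} {v : L2R} {f : ℕ → ℝ → ℂ} {g : ℝ → ℂ}
    {B : ℝ → ℝ} (hu : ∀ m, u m =ᵐ[volume] f m) (hv : v =ᵐ[volume] g)
    (hB : MemLp B 2 (volume : Measure ℝ)) (hfB : ∀ m x, ‖f m x - g x‖ ≤ B x)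
    (hlim : ∀ x, Tendsto (fun m => f m x) atTop (𝓝 (g x))) : Tendsto u atTop (𝓝 v) := by
  have hsub : ∀ m, (u m - v : L2R) =ᵐ[volume] fun x => f m x - g x := fun m => by
    filter_upwards [Lp.coeFn_sub (u m) v, hu m, hv] with x h1 h2 h3
    rw [h1, Pi.sub_apply, h2, h3]
  have h : Tendsto (fun m => ∫ x, ‖(u m - v : L2R) x‖ ^ 2) atTop (𝓝 (∫ _ : ℝ, (0 : ℝ))) := by
    refine tendsto_integral_of_dominated_convergence (fun x => B x ^ 2)
      (fun m => (Lp.aestronglyMeasurable _).norm.pow 2)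
      ((memLp_two_iff_integrable_sq hB.1).1 hB) (fun m => ?_) ?_
    · filter_upwards [hsub m] with x hx
      rw [hx, Real.norm_of_nonneg (by positivity)]
      gcongr
      exact hfB m x
    · filter_upwards [ae_all_iff.2 hsub] with x hx
      simp only [hx]
      have := ((hlim x).sub_const (g x)).norm.pow 2
      simpa using this
  simp only [← norm_sq_eq_integral, integral_zero] at h
  rw [tendsto_iff_norm_sub_tendsto_zero]
  have := h.sqrt
  simpa [Real.sqrt_sq (norm_nonneg _)] using this

theorem fiberExpr_mul {χ ψ : ℝ → ℂ} (hχ : ContDiff ℝ ∞ χ) (hψ : ContDiff ℝ ∞ ψ) (b : ℝ)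
    (V : ℝ → ℝ) (k c x : ℝ) :
    fiberExpr b V k (fun x => χ (c * x) * ψ x) x = χ (c * x) * fiberExpr b V k ψ x -
      2 * (c * deriv χ (c * x)) * deriv ψ x - c ^ 2 * deriv (deriv χ) (c * x) * ψ x := by
  have hd : ∀ {f : ℝ → ℂ}, ContDiff ℝ ∞ f → ∀ x, HasDerivAt f (deriv f x) x := fun hf x =>
    (hf.differentiable (by simp) x).hasDerivAt
  have hχ' := (contDiff_infty_iff_deriv.1 hχ).2
  have hψ' := (contDiff_infty_iff_deriv.1 hψ).2
  have hc : ∀ {f : ℝ → ℂ}, ContDiff ℝ ∞ f → ∀ x,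
      HasDerivAt (fun x => f (c * x)) (c * deriv f (c * x)) x := fun {f} hf x => by
    have := (hd hf (c * x)).scomp x ((hasDerivAt_id x).const_mul c)
    simpa using! this
  have h1 : deriv (fun x => χ (c * x) * ψ x) =
      fun x => c * deriv χ (c * x) * ψ x + χ (c * x) * deriv ψ x :=
    funext fun x => ((hc hχ x).mul (hd hψ x)).deriv
  have h2 := ((((hc hχ' x).const_mul (c : ℂ)).mul (hd hψ x)).add ((hc hχ x).mul (hd hψ' x))).deriv
  have h3 : deriv (fun x => c * deriv χ (c * x) * ψ x + χ (c * x) * deriv ψ x) x = _ := h2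
  rw [fiberExpr, fiberExpr, h1, h3]
  ring

/-- A smooth function in `L²` whose derivative and image under the differential expression are in
`L²` belongs, with this image, to the closure of the minimal graph. -/
theorem mem_closure_minimalGraph_of_contDiff {b k : ℝ} {V : ℝ → ℝ} {ψ : ℝ → ℂ}
    (hψ : ContDiff ℝ ∞ ψ) (h0 : MemLp ψ 2 (volume : Measure ℝ))
    (h1 : MemLp (deriv ψ) 2 (volume : Measure ℝ))
    (h2 : MemLp (fiberExpr b V k ψ) 2 (volume : Measure ℝ)) :
    (h0.toLp ψ, h2.toLp _) ∈ (minimalGraph b V k).topologicalClosure := by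
  let β : ContDiffBump (0 : ℝ) := ⟨1, 2, one_pos, one_lt_two⟩
  let χ : ℝ → ℂ := fun x => (β x : ℂ)
  have hχ : ContDiff ℝ ∞ χ := Complex.ofRealCLM.contDiff.comp β.contDiff
  have hχs : HasCompactSupport χ :=
    β.hasCompactSupport.comp_left (g := fun r : ℝ => (r : ℂ)) (by simp)
  have hχ' := (contDiff_infty_iff_deriv.1 hχ).2
  have hχ'' := (contDiff_infty_iff_deriv.1 hχ').2
  have hχ1 : ∀ x, ‖χ x - 1‖ ≤ 1 := fun x => by
    rw [← Complex.ofReal_one, ← Complex.ofReal_sub, Complex.norm_real, Real.norm_eq_abs, abs_le]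
    constructor <;> linarith [β.nonneg (x := x), β.le_one (x := x)]
  have hχ0 : χ 0 = 1 := by
    simp only [χ, β.one_of_mem_closedBall (by simp [β] : (0 : ℝ) ∈ Metric.closedBall 0 β.rIn)]
    simp
  obtain ⟨C₁, hC₁⟩ := hχs.deriv.exists_bound_of_continuous hχ'.continuous
  obtain ⟨C₂, hC₂⟩ := hχs.deriv.deriv.exists_bound_of_continuous hχ''.continuous
  let c : ℕ → ℝ := fun m => 1 / ((m : ℝ) + 1)
  have hcpos : ∀ m, 0 < c m := fun m => by positivity
  have hc1 : ∀ m, c m ≤ 1 := fun m => by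
    simp only [c]
    rw [div_le_one (by positivity)]
    linarith [m.cast_nonneg (α := ℝ)]
  have hc0 : Tendsto c atTop (𝓝 0) := tendsto_one_div_add_atTop_nhds_zero_nat
  have hcC : Tendsto (fun m => (c m : ℂ)) atTop (𝓝 0) := by
    simpa using! (Complex.continuous_ofReal.tendsto 0).comp hc0
  let φ : ℕ → ℝ → ℂ := fun m x => χ (c m * x) * ψ x
  have hφ : ∀ m, ContDiff ℝ ∞ (φ m) := fun m =>
    (hχ.comp (contDiff_const.mul contDiff_id)).mul hψ
  have hφs : ∀ m, HasCompactSupport (φ m) := fun m =>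
    (hχs.comp_homeomorph (Homeomorph.mulLeft₀ (c m) (hcpos m).ne')).mul_right
  have hform : ∀ m x, fiberExpr b V k (φ m) x = _ := fun m x =>
    fiberExpr_mul hχ hψ b V k (c m) x
  have hcx : ∀ {f : ℝ → ℂ}, Continuous f → ∀ x,
      Tendsto (fun m => f (c m * x)) atTop (𝓝 (f 0)) := fun {f} hf x => by
    refine (hf.tendsto 0).comp ?_
    simpa using hc0.mul_const x
  have hB1 : ∀ m x, ‖φ m x - ψ x‖ ≤ ‖ψ x‖ := fun m x => by
    have : φ m x - ψ x = (χ (c m * x) - 1) * ψ x := by simp only [φ]; ring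
    rw [this, norm_mul]
    exact mul_le_of_le_one_left (norm_nonneg _) (hχ1 _)
  have hB2 : ∀ m x, ‖fiberExpr b V k (φ m) x - fiberExpr b V k ψ x‖ ≤
      ‖fiberExpr b V k ψ x‖ + 2 * C₁ * ‖deriv ψ x‖ + C₂ * ‖ψ x‖ := fun m x => by
    have : fiberExpr b V k (φ m) x - fiberExpr b V k ψ x =
        (χ (c m * x) - 1) * fiberExpr b V k ψ x - 2 * (c m * deriv χ (c m * x)) * deriv ψ x -
          c m ^ 2 * deriv (deriv χ) (c m * x) * ψ x := by rw [hform]; ring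
    rw [this]
    have hn : ‖(c m : ℂ)‖ ≤ 1 := by
      rw [Complex.norm_real, Real.norm_of_nonneg (hcpos m).le]; exact hc1 m
    refine (norm_sub_le _ _).trans (add_le_add ((norm_sub_le _ _).trans (add_le_add ?_ ?_)) ?_)
    · rw [norm_mul]
      exact mul_le_of_le_one_left (norm_nonneg _) (hχ1 _)
    · rw [norm_mul, norm_mul, norm_mul, Complex.norm_ofNat]
      gcongr
      calc _ ≤ 1 * C₁ := by gcongr; exact hC₁ _
        _ = C₁ := one_mul _
    · rw [norm_mul, norm_mul, norm_pow]
      gcongr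
      calc _ ≤ 1 ^ 2 * C₂ := by gcongr; exact hC₂ _
        _ = C₂ := by ring
  have hm1 : ∀ m, MemLp (φ m) 2 (volume : Measure ℝ) := fun m =>
    (hφ m).continuous.memLp_of_hasCompactSupport (hφs m)
  have hsub : ∀ m, MemLp (fun x => fiberExpr b V k (φ m) x - fiberExpr b V k ψ x) 2
      (volume : Measure ℝ) := fun m => by
    have hcχ : ∀ {f : ℝ → ℂ}, Continuous f → AEStronglyMeasurable (fun x => f (c m * x)) volume :=
      fun hf => (hf.comp (continuous_const.mul continuous_id)).aestronglyMeasurable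
    refine MemLp.mono' (g := fun x => ‖fiberExpr b V k ψ x‖ + 2 * C₁ * ‖deriv ψ x‖ + C₂ * ‖ψ x‖)
      ((h2.norm.add (h1.norm.const_mul _)).add (h0.norm.const_mul _)) ?_ (ae_of_all _ (hB2 m))
    simp only [hform]
    exact (((((hcχ hχ.continuous).mul h2.1).sub (((hcχ hχ'.continuous).const_mul _).const_mul _
      |>.mul h1.1)).sub (((hcχ hχ''.continuous).const_mul _).mul h0.1))).sub h2.1
  have hm2 : ∀ m, MemLp (fiberExpr b V k (φ m)) 2 (volume : Measure ℝ) := fun m => by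
    convert! (hsub m).add h2 using 1
    funext x
    simp
  refine mem_closure_of_tendsto (f := fun m => ((hm1 m).toLp _, (hm2 m).toLp _)) (b := atTop) ?_
    (Eventually.of_forall fun m => ⟨φ m, hφ m, hφs m, (hm1 m).coeFn_toLp, (hm2 m).coeFn_toLp⟩)
  refine Tendsto.prodMk_nhds ?_ ?_
  · refine tendsto_L2R_of_dominated (fun m => (hm1 m).coeFn_toLp) h0.coeFn_toLp h0.norm hB1
      fun x => ?_
    simpa [hχ0] using (hcx hχ.continuous x).mul_const (ψ x)
  · refine tendsto_L2R_of_dominated (fun m => (hm2 m).coeFn_toLp) h2.coeFn_toLp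
      ((h2.norm.add (h1.norm.const_mul (2 * C₁))).add (h0.norm.const_mul C₂)) hB2 fun x => ?_
    simp only [hform]
    have := (((hcx hχ.continuous x).mul_const (fiberExpr b V k ψ x)).sub
      (((hcC.mul (hcx hχ'.continuous x)).const_mul 2).mul_const (deriv ψ x))).sub
      (((hcC.pow 2).mul (hcx hχ''.continuous x)).mul_const (ψ x))
    simpa [hχ0] using this

theorem integral_mul_deriv_deriv {φ ψ : ℝ → ℂ} (hφ : ContDiff ℝ ∞ φ) (hφs : HasCompactSupport φ)
    (hψ : ContDiff ℝ ∞ ψ) :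
    ∫ x, ψ x * deriv (deriv φ) x = ∫ x, deriv (deriv ψ) x * φ x := by
  have hd : ∀ {f : ℝ → ℂ}, ContDiff ℝ ∞ f → ∀ x, HasDerivAt f (deriv f x) x := fun hf x =>
    (hf.differentiable (by simp) x).hasDerivAt
  have hφ' := (contDiff_infty_iff_deriv.1 hφ).2
  have hφ'' := (contDiff_infty_iff_deriv.1 hφ').2
  have hψ' := (contDiff_infty_iff_deriv.1 hψ).2
  have hψ'' := (contDiff_infty_iff_deriv.1 hψ').2
  have hi : ∀ {f g : ℝ → ℂ}, Continuous f → Continuous g → HasCompactSupport g →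
      Integrable (f * g) := fun hf hg hgs =>
    (hf.mul hg).integrable_of_hasCompactSupport hgs.mul_left
  rw [integral_mul_deriv_eq_deriv_mul_of_integrable (fun x _ => hd hψ x) (fun x _ => hd hφ' x)
    (hi hψ.continuous hφ''.continuous hφs.deriv.deriv)
    (hi hψ'.continuous hφ'.continuous hφs.deriv) (hi hψ.continuous hφ'.continuous hφs.deriv),
    integral_mul_deriv_eq_deriv_mul_of_integrable (fun x _ => hd hψ' x) (fun x _ => hd hφ x)
    (hi hψ'.continuous hφ'.continuous hφs.deriv)
    (hi hψ''.continuous hφ.continuous hφs) (hi hψ'.continuous hφ.continuous hφs), neg_neg]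

theorem memLp_ofReal_polyGauss (q : ℝ[X]) :
    MemLp (fun y => (polyGauss q y : ℂ)) 2 (volume : Measure ℝ) :=
  (memLp_polyGauss q).ofReal

theorem contDiff_ofReal_polyGauss (q : ℝ[X]) : ContDiff ℝ ∞ fun y => (polyGauss q y : ℂ) :=
  Complex.ofRealCLM.contDiff.comp (contDiff_polyGauss q)

theorem deriv_ofReal_polyGauss (q : ℝ[X]) :
    deriv (fun y => (polyGauss q y : ℂ)) = fun y => (polyGauss (derivative q - X * q) y : ℂ) :=
  funext fun y => (hasDerivAt_polyGauss q y).ofReal_comp.deriv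

/-- The class of `q(y) exp(-y²/2)` in `L²(ℝ)`. -/
noncomputable def polyGaussLp (q : ℝ[X]) : L2R := (memLp_ofReal_polyGauss q).toLp _

theorem coeFn_polyGaussLp (q : ℝ[X]) :
    polyGaussLp q =ᵐ[volume] fun y => (polyGauss q y : ℂ) :=
  (memLp_ofReal_polyGauss q).coeFn_toLp

/-- The action of the harmonic oscillator on the polynomial factor of `q(y) exp(-y²/2)`. -/
noncomputable def oscillatorPoly (q : ℝ[X]) : ℝ[X] :=
  -(derivative (derivative q - X * q) - X * (derivative q - X * q)) + X ^ 2 * q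

theorem fiberExpr_polyGauss (V : ℝ → ℝ) (q : ℝ[X]) :
    fiberExpr 1 V 0 (fun y => (polyGauss q y : ℂ)) =
      fun y => (polyGauss (oscillatorPoly q) y : ℂ) + (V y : ℂ) * (polyGauss q y : ℂ) := by
  funext y
  rw [fiberExpr, deriv_ofReal_polyGauss, deriv_ofReal_polyGauss, oscillatorPoly]
  simp only [polyGauss, eval_add, eval_neg, eval_sub, eval_mul, eval_pow, eval_X]
  push_cast
  ring

theorem polyGaussLp_mem_closure {V : ℝ → ℝ} (hV : IsBddCont V) (q : ℝ[X]) :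
    (polyGaussLp q, polyGaussLp (oscillatorPoly q) + mulOp V (polyGaussLp q)) ∈
      (minimalGraph 1 V 0).topologicalClosure := by
  have h2 : MemLp (fiberExpr 1 V 0 fun y => (polyGauss q y : ℂ)) 2 (volume : Measure ℝ) := by
    rw [fiberExpr_polyGauss]
    exact (memLp_ofReal_polyGauss _).add (hV.memLp_mul (memLp_ofReal_polyGauss q))
  have h := mem_closure_minimalGraph_of_contDiff (contDiff_ofReal_polyGauss q)
    (memLp_ofReal_polyGauss q)
    (by rw [deriv_ofReal_polyGauss]; exact memLp_ofReal_polyGauss _) h2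
  convert! h using 2
  refine Lp.ext ?_
  filter_upwards [h2.coeFn_toLp, coeFn_polyGaussLp (oscillatorPoly q), coeFn_polyGaussLp q,
    coeFn_mulOp hV (polyGaussLp q),
    Lp.coeFn_add (polyGaussLp (oscillatorPoly q)) (mulOp V (polyGaussLp q))] with x e1 e2 e3 e4 e5
  rw [e1, e5, Pi.add_apply, e2, e4, e3, fiberExpr_polyGauss]

theorem inner_polyGaussLp (q : ℝ[X]) {u : L2R} {f : ℝ → ℂ} (hu : u =ᵐ[volume] f) :
    inner ℂ (polyGaussLp q) u = ∫ x, (polyGauss q x : ℂ) * f x := by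
  rw [L2.inner_def]
  refine integral_congr_ae ?_
  filter_upwards [coeFn_polyGaussLp q, hu] with x h1 h2
  rw [h1, h2]
  simp [mul_comm]

theorem inner_polyGaussLp_of_mem_closure {V : ℝ → ℝ} (hV : IsBddCont V) (q : ℝ[X])
    {p : L2R × L2R} (hp : p ∈ (minimalGraph 1 V 0).topologicalClosure) :
    inner ℂ (polyGaussLp q) p.2 - inner ℂ (polyGaussLp q) (mulOp V p.1) =
      inner ℂ (polyGaussLp (oscillatorPoly q)) p.1 := by
  have hcl : IsClosed {p : L2R × L2R | inner ℂ (polyGaussLp q) p.2 -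
      inner ℂ (polyGaussLp q) (mulOp V p.1) = inner ℂ (polyGaussLp (oscillatorPoly q)) p.1} :=
    isClosed_eq (by fun_prop) (by fun_prop)
  refine closure_minimal (s := (minimalGraph 1 V 0 : Set (L2R × L2R))) ?_ hcl hp
  rintro ⟨u, f⟩ ⟨φ, hφ, hφs, hu, hf⟩
  have hm : mulOp V u =ᵐ[volume] fun x => (V x : ℂ) * φ x := by
    filter_upwards [coeFn_mulOp hV u, hu] with x h1 h2
    rw [h1, h2]
  have hφ'' := (contDiff_infty_iff_deriv.1 (contDiff_infty_iff_deriv.1 hφ).2).2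
  have hq := (contDiff_ofReal_polyGauss q).continuous
  have hi : ∀ {f g : ℝ → ℂ}, Continuous f → Continuous g → HasCompactSupport g →
      Integrable (fun x => f x * g x) := fun hf hg hgs =>
    (hf.mul hg).integrable_of_hasCompactSupport hgs.mul_left
  have hsub : Integrable fun x => (polyGauss q x : ℂ) * deriv (deriv φ) x :=
    hi hq hφ''.continuous hφs.deriv.deriv
  change inner ℂ (polyGaussLp q) f - inner ℂ (polyGaussLp q) (mulOp V u) =
    inner ℂ (polyGaussLp (oscillatorPoly q)) u
  have hadd : inner ℂ (polyGaussLp q) f - inner ℂ (polyGaussLp q) (mulOp V u) =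
      inner ℂ (polyGaussLp q) (f - mulOp V u) := (inner_sub_right _ _ _).symm
  have hfm : (f - mulOp V u : L2R) =ᵐ[volume] fun x => -deriv (deriv φ) x + (x ^ 2 : ℝ) * φ x := by
    filter_upwards [Lp.coeFn_sub f (mulOp V u), hf, hm] with x h1 h2 h3
    rw [h1, Pi.sub_apply, h2, h3, fiberExpr]
    push_cast
    ring
  rw [hadd, inner_polyGaussLp q hfm, inner_polyGaussLp _ hu, ← sub_eq_zero]
  have hsq : Integrable fun x => ((x ^ 2 * polyGauss q x : ℝ) : ℂ) * φ x :=
    hi (Complex.continuous_ofReal.comp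
      ((continuous_pow 2).mul (contDiff_polyGauss q).continuous)) hφ.continuous hφs
  have h1 : ∫ x, (polyGauss q x : ℂ) * (-deriv (deriv φ) x + (x ^ 2 : ℝ) * φ x) =
      (∫ x, (x ^ 2 * polyGauss q x : ℝ) * φ x) - ∫ x, (polyGauss q x : ℂ) * deriv (deriv φ) x := by
    rw [← integral_sub hsq hsub]
    refine integral_congr_ae (ae_of_all _ fun x => ?_)
    push_cast
    ring
  have hψ'' := (contDiff_infty_iff_deriv.1 (contDiff_infty_iff_deriv.1
    (contDiff_ofReal_polyGauss q)).2).2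
  rw [h1, integral_mul_deriv_deriv hφ hφs (contDiff_ofReal_polyGauss q), sub_eq_zero,
    ← integral_sub hsq (hi hψ''.continuous hφ.continuous hφs)]
  refine integral_congr_ae (ae_of_all _ fun x => ?_)
  rw [deriv_ofReal_polyGauss, deriv_ofReal_polyGauss]
  simp only [oscillatorPoly, polyGauss, eval_add, eval_neg, eval_sub,
    eval_mul, eval_pow, eval_X]
  push_cast
  ring

end Oscillator

section Basis

open Polynomial Filter Topology

theorem integral_hermiteAux_sq_pos (n : ℕ) : 0 < ∫ z, hermiteAux n z ^ 2 := by
  rw [hermiteAux_eq]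
  have hq : scaledHermite n ≠ 0 := by
    intro h
    have := degree_scaledHermite n
    simp [h] at this
  obtain ⟨x, hx⟩ : ∃ x, (scaledHermite n).eval x ≠ 0 := by
    by_contra! h
    exact hq (Polynomial.funext (by simpa using h))
  have hc := (contDiff_polyGauss (scaledHermite n)).continuous
  refine integral_pos_of_integrable_nonneg_nonzero (x := x) (hc.pow 2)
    ((memLp_two_iff_integrable_sq hc.aestronglyMeasurable).1 (memLp_polyGauss _))
    (fun y => sq_nonneg _) ?_
  simp [polyGauss, hx]

/-- The polynomial factor of the normalized Hermite function of degree `n`. -/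
noncomputable def hermitePoly (n : ℕ) : ℝ[X] :=
  C (√(∫ z, hermiteAux n z ^ 2))⁻¹ * scaledHermite n

theorem hermiteFun_eq (n : ℕ) : hermiteFun (n + 1) = polyGauss (hermitePoly n) := by
  funext y
  simp only [hermiteFun, polyGauss, hermitePoly, eval_mul, eval_C, Nat.add_sub_cancel]
  rw [hermiteAux_eq]
  simp only [polyGauss]
  ring

theorem integral_hermitePoly_sq (n : ℕ) : ∫ y, polyGauss (hermitePoly n) y ^ 2 = 1 := by
  have h := integral_hermiteAux_sq_pos n
  rw [← hermiteFun_eq]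
  simp only [hermiteFun, Nat.add_sub_cancel, div_pow, Real.sq_sqrt h.le]
  rw [integral_div, div_self h.ne']

theorem oscillatorPoly_hermitePoly (n : ℕ) :
    oscillatorPoly (hermitePoly n) = C (2 * n + 1 : ℝ) * hermitePoly n := by
  have h := scaledHermite_ode n
  simp only [oscillatorPoly, hermitePoly, derivative_mul, derivative_C, derivative_sub,
    derivative_X, zero_mul, zero_add, C_add, C_mul, C_1, map_natCast, one_mul]
  have h2 : (C 2 : ℝ[X]) = 2 := rfl
  rw [h2]
  linear_combination -C (√(∫ z, hermiteAux n z ^ 2))⁻¹ * h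

theorem polyGaussLp_C_mul (c : ℝ) (q : ℝ[X]) :
    polyGaussLp (C c * q) = (c : ℂ) • polyGaussLp q := by
  refine Lp.ext ?_
  filter_upwards [coeFn_polyGaussLp (C c * q), coeFn_polyGaussLp q,
    Lp.coeFn_smul (c : ℂ) (polyGaussLp q)] with x h1 h2 h3
  rw [h1, h3, Pi.smul_apply, h2]
  simp [polyGauss, mul_assoc]

theorem isBddCont_zero : IsBddCont fun _ => 0 := ⟨continuous_const, 0, by simp⟩

theorem oscillatorPoly_hermiteLp (n : ℕ) : polyGaussLp (oscillatorPoly (hermitePoly n)) =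
    (2 * n + 1 : ℂ) • polyGaussLp (hermitePoly n) := by
  rw [oscillatorPoly_hermitePoly, polyGaussLp_C_mul]
  push_cast
  rfl

theorem orthonormal_hermite : Orthonormal ℂ fun n => polyGaussLp (hermitePoly n) := by
  constructor
  · intro n
    have h : ‖polyGaussLp (hermitePoly n)‖ ^ 2 = 1 := by
      rw [norm_sq_eq_integral, ← integral_hermitePoly_sq n]
      refine integral_congr_ae ?_
      filter_upwards [coeFn_polyGaussLp (hermitePoly n)] with x hx
      rw [hx, Complex.norm_real, Real.norm_eq_abs, sq_abs]
    exact (pow_eq_one_iff_of_nonneg (norm_nonneg _) two_ne_zero).1 h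
  · intro m n hmn
    have h := inner_polyGaussLp_of_mem_closure isBddCont_zero (hermitePoly m)
      (polyGaussLp_mem_closure isBddCont_zero (hermitePoly n))
    simp only [inner_add_right, add_sub_cancel_right, oscillatorPoly_hermiteLp, inner_smul_left,
      inner_smul_right] at h
    simp only [map_add, map_mul, map_one, Complex.conj_ofNat, Complex.conj_natCast] at h
    have h2 : ((2 * n + 1 : ℂ) - (2 * m + 1)) *
      inner ℂ (polyGaussLp (hermitePoly m)) (polyGaussLp (hermitePoly n)) = 0 := by
      linear_combination h
    refine (mul_eq_zero.1 h2).resolve_left ?_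
    rw [← ne_eq, ← norm_pos_iff]
    linarith [two_le_norm_odd_sub hmn]

theorem eq_zero_of_inner_hermite_eq_zero {u : L2R}
    (h : ∀ n, inner ℂ (polyGaussLp (hermitePoly n)) u = 0) : u = 0 := by
  have hi : ∀ n, ∫ x, (polyGauss (scaledHermite n) x : ℂ) * u x = 0 := fun n => by
    have h1 := h n
    rw [hermitePoly, polyGaussLp_C_mul, inner_smul_left, Complex.conj_ofReal, mul_eq_zero,
      Complex.ofReal_eq_zero, inv_eq_zero, Real.sqrt_eq_zero'] at h1
    have h2 := h1.resolve_left (integral_hermiteAux_sq_pos n).not_ge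
    rwa [inner_polyGaussLp _ (Filter.EventuallyEq.refl _ _)] at h2
  have hint : ∀ n, Integrable fun x => (polyGauss (scaledHermite n) x : ℂ) * u x := fun n =>
    (memLp_ofReal_polyGauss _).integrable_mul (Lp.memLp u)
  have hre := ae_eq_zero_of_integral_mul_polyGauss_eq_zero (Lp.memLp u).re
    (integral_mul_polyGauss_eq_zero (Lp.memLp u).re fun n => by
      have h1 := congrArg Complex.re (hi n)
      rw [← RCLike.re_eq_complex_re, ← integral_re (hint n)] at h1
      simpa [mul_comm] using h1)
  have him := ae_eq_zero_of_integral_mul_polyGauss_eq_zero (Lp.memLp u).im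
    (integral_mul_polyGauss_eq_zero (Lp.memLp u).im fun n => by
      have h1 := congrArg Complex.im (hi n)
      rw [← RCLike.im_eq_complex_im, ← integral_im (hint n)] at h1
      simpa [mul_comm] using h1)
  rw [Lp.eq_zero_iff_ae_eq_zero]
  filter_upwards [hre, him] with x h1 h2
  exact Complex.ext h1 h2

/-- The Hermite functions as a Hilbert basis of `L²(ℝ)`. -/
noncomputable def hermiteBasis : HilbertBasis ℕ ℂ L2R :=
  HilbertBasis.mkOfOrthogonalEqBot orthonormal_hermite (by
    rw [Submodule.eq_bot_iff]
    intro u hu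
    exact eq_zero_of_inner_hermite_eq_zero fun n =>
      (Submodule.mem_orthogonal _ u).1 hu _ (Submodule.subset_span ⟨n, rfl⟩))

theorem hermiteBasis_apply (n : ℕ) : hermiteBasis n = polyGaussLp (hermitePoly n) := by
  simp [hermiteBasis]

/-- The closure of the minimal graph for `b = 1`, `k = 0` in the Hermite basis. -/
theorem mem_closure_minimalGraph_iff {V : ℝ → ℝ} (hV : IsBddCont V) (p : L2R × L2R) :
    p ∈ (minimalGraph 1 V 0).topologicalClosure ↔
      ∀ n : ℕ, (2 * n + 1) * inner ℂ (hermiteBasis n) p.1 =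
        inner ℂ (hermiteBasis n) (p.2 - mulOp V p.1) := by
  constructor
  · intro hp n
    have h := inner_polyGaussLp_of_mem_closure hV (hermitePoly n) hp
    rw [oscillatorPoly_hermiteLp, inner_smul_left] at h
    rw [hermiteBasis_apply, inner_sub_right, h]
    simp only [map_add, map_mul, map_one, Complex.conj_ofNat, Complex.conj_natCast]
  · intro h
    obtain ⟨u, f⟩ := p
    simp only at h
    have h1 := hermiteBasis.hasSum_repr u
    have h2 := (hermiteBasis.hasSum_repr (f - mulOp V u)).add
      ((mulOp V).hasSum h1)
    rw [sub_add_cancel] at h2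
    refine isClosed_closure.mem_of_tendsto (h1.prodMk h2) (Eventually.of_forall fun s => ?_)
    refine Submodule.sum_mem (minimalGraph 1 V 0).topologicalClosure fun n _ => ?_
    have h3 := Submodule.smul_mem _ (hermiteBasis.repr u n)
      (polyGaussLp_mem_closure hV (hermitePoly n))
    convert! h3 using 1
    rw [Prod.smul_mk, smul_add, oscillatorPoly_hermiteLp, smul_smul, map_smul,
      hermiteBasis.repr_apply_apply, hermiteBasis.repr_apply_apply, ← h n, hermiteBasis_apply,
      mul_comm]

end Basis

section Scaling

open Filter Topology

theorem quasiMeasurePreserving_affine {a : ℝ} (ha : a ≠ 0) (c : ℝ) :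
    Measure.QuasiMeasurePreserving (fun x : ℝ => a * x + c) volume volume :=
  (measurePreserving_add_right volume c).quasiMeasurePreserving.comp
    (Measure.quasiMeasurePreserving_smul (volume : Measure ℝ) ha)

theorem integrable_comp_affine {f : ℝ → ℝ} (hf : Integrable f) {a : ℝ} (ha : a ≠ 0) (c : ℝ) :
    Integrable fun x => f (a * x + c) :=
  (hf.comp_add_right c).comp_mul_left' ha

theorem integral_comp_affine (f : ℝ → ℝ) (a c : ℝ) :
    ∫ x, f (a * x + c) = |a⁻¹| * ∫ x, f x := by
  rw [Measure.integral_comp_mul_left (fun x => f (x + c)) a, integral_add_right_eq_self,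
    smul_eq_mul]

theorem memLp_comp_affine {f : ℝ → ℂ} (hf : MemLp f 2 (volume : Measure ℝ)) {a : ℝ} (ha : a ≠ 0)
    (c : ℝ) : MemLp (fun x => f (a * x + c)) 2 (volume : Measure ℝ) := by
  refine (memLp_two_iff_integrable_sq_norm
    (hf.1.comp_quasiMeasurePreserving (quasiMeasurePreserving_affine ha c))).2 ?_
  exact integrable_comp_affine ((memLp_two_iff_integrable_sq_norm hf.1).1 hf) ha c

/-- Composition with the affine map `x ↦ a x + c` in `L²(ℝ)`. -/
noncomputable def affineComp {a : ℝ} (ha : a ≠ 0) (c : ℝ) : L2R →ₗ[ℂ] L2R where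
  toFun u := (memLp_comp_affine (Lp.memLp u) ha c).toLp _
  map_add' u v := by
    refine Lp.ext ?_
    filter_upwards [(memLp_comp_affine (Lp.memLp (u + v)) ha c).coeFn_toLp,
      (memLp_comp_affine (Lp.memLp u) ha c).coeFn_toLp,
      (memLp_comp_affine (Lp.memLp v) ha c).coeFn_toLp,
      (quasiMeasurePreserving_affine ha c).ae (Lp.coeFn_add u v),
      Lp.coeFn_add ((memLp_comp_affine (Lp.memLp u) ha c).toLp _)
        ((memLp_comp_affine (Lp.memLp v) ha c).toLp _)] with x h1 h2 h3 h4 h5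
    rw [h1, h5, Pi.add_apply, h2, h3, h4, Pi.add_apply]
  map_smul' r u := by
    refine Lp.ext ?_
    filter_upwards [(memLp_comp_affine (Lp.memLp (r • u)) ha c).coeFn_toLp,
      (memLp_comp_affine (Lp.memLp u) ha c).coeFn_toLp,
      (quasiMeasurePreserving_affine ha c).ae (Lp.coeFn_smul r u),
      Lp.coeFn_smul r ((memLp_comp_affine (Lp.memLp u) ha c).toLp _)] with x h1 h2 h3 h4
    rw [h1, RingHom.id_apply, h4, Pi.smul_apply, h2, h3, Pi.smul_apply]

theorem coeFn_affineComp {a : ℝ} (ha : a ≠ 0) (c : ℝ) {u : L2R} {f : ℝ → ℂ}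
    (hu : u =ᵐ[volume] f) : affineComp ha c u =ᵐ[volume] fun x => f (a * x + c) :=
  (memLp_comp_affine (Lp.memLp u) ha c).coeFn_toLp.trans
    ((quasiMeasurePreserving_affine ha c).ae hu)

theorem continuous_affineComp {a : ℝ} (ha : a ≠ 0) (c : ℝ) : Continuous (affineComp ha c) := by
  refine (LinearMap.mkContinuous (affineComp ha c) (√|a⁻¹|) fun u => ?_).continuous
  refine abs_le_of_sq_le_sq' ?_ (by positivity) |>.2
  rw [mul_pow, Real.sq_sqrt (abs_nonneg _), norm_sq_eq_integral, norm_sq_eq_integral,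
    ← integral_comp_affine]
  refine (integral_congr_ae ?_).le
  filter_upwards [coeFn_affineComp ha c (ae_eq_refl u)] with x hx
  rw [hx]

theorem affineComp_affineComp {a a' : ℝ} (ha : a ≠ 0) (ha' : a' ≠ 0) {c c' : ℝ} (h : a' * a = 1)
    (hc : a' * c + c' = 0) (u : L2R) : affineComp ha c (affineComp ha' c' u) = u := by
  refine Lp.ext ?_
  filter_upwards [coeFn_affineComp ha c (coeFn_affineComp ha' c' (ae_eq_refl u))] with x hx
  rw [hx]
  congr 1
  linear_combination x * h + hc

/-- The rescaled potential `y ↦ b⁻¹ W(b^{-1/2} y + k/b)`. -/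
noncomputable def scaledPotential (W : ℝ → ℝ) (b k y : ℝ) : ℝ := b⁻¹ * W ((√b)⁻¹ * y + k / b)

theorem IsBddCont.scaledPotential {W : ℝ → ℝ} (hW : IsBddCont W) (b k : ℝ) :
    IsBddCont (scaledPotential W b k) :=
  (hW.comp_continuous (g := fun y => (√b)⁻¹ * y + k / b) (by fun_prop)).const_mul _

theorem fiberExpr_scaled {b : ℝ} (hb : 0 < b) (W : ℝ → ℝ) (k : ℝ) {φ : ℝ → ℂ}
    (hφ : ContDiff ℝ ∞ φ) (y : ℝ) :
    fiberExpr 1 (scaledPotential W b k) 0 (fun y => φ ((√b)⁻¹ * y + k / b)) y =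
      (b⁻¹ : ℂ) * fiberExpr b W k φ ((√b)⁻¹ * y + k / b) := by
  have hc : ∀ {f : ℝ → ℂ}, ContDiff ℝ ∞ f →
      deriv (fun y => f ((√b)⁻¹ * y + k / b)) =
        (((√b)⁻¹ : ℝ) : ℂ) • fun y => deriv f ((√b)⁻¹ * y + k / b) := fun {f} hf => by
    funext x
    have h1 := (hf.differentiable (by simp) ((√b)⁻¹ * x + k / b)).hasDerivAt
    have := (h1.scomp x (((hasDerivAt_id x).const_mul (√b)⁻¹).add_const (k / b))).deriv
    simpa using! this
  have hφ' := (contDiff_infty_iff_deriv.1 hφ).2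
  have hs : (√b) ^ 2 = b := Real.sq_sqrt hb.le
  have hs0 : √b ≠ 0 := (Real.sqrt_pos.2 hb).ne'
  have h2 : deriv (deriv fun y => φ ((√b)⁻¹ * y + k / b)) y =
      (b⁻¹ : ℂ) * deriv (deriv φ) ((√b)⁻¹ * y + k / b) := by
    rw [hc hφ, deriv_const_smul_field, hc hφ', Pi.smul_apply, smul_smul, smul_eq_mul]
    congr 1
    rw [← Complex.ofReal_mul, ← mul_inv, ← sq, hs, Complex.ofReal_inv]
  have h3 : ((1 * y - 0) ^ 2 + scaledPotential W b k y : ℝ) =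
      b⁻¹ * ((b * ((√b)⁻¹ * y + k / b) - k) ^ 2 + W ((√b)⁻¹ * y + k / b)) := by
    have h4 : b * ((√b)⁻¹ * y + k / b) - k = √b * y := by
      have hbs : b * (√b)⁻¹ = √b := by rw [mul_inv_eq_iff_eq_mul₀ hs0, ← sq, hs]
      rw [mul_add, ← mul_assoc, hbs, mul_div_cancel₀ _ hb.ne', add_sub_cancel_right]
    rw [h4, mul_pow, hs, scaledPotential]
    field_simp
    ring
  rw [fiberExpr, fiberExpr, h2, h3]
  push_cast
  ring

theorem sqrt_inv_ne_zero {b : ℝ} (hb : 0 < b) : (√b)⁻¹ ≠ 0 := inv_ne_zero (Real.sqrt_pos.2 hb).ne'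

theorem mem_minimalGraph_scaled {b : ℝ} (hb : 0 < b) {W : ℝ → ℝ} {k : ℝ} {p : L2R × L2R}
    (hp : p ∈ minimalGraph b W k) :
    (affineComp (sqrt_inv_ne_zero hb) (k / b) p.1,
      (b⁻¹ : ℂ) • affineComp (sqrt_inv_ne_zero hb) (k / b) p.2) ∈
        minimalGraph 1 (scaledPotential W b k) 0 := by
  obtain ⟨φ, hφ, hφs, h1, h2⟩ := hp
  refine ⟨fun y => φ ((√b)⁻¹ * y + k / b), hφ.comp (by fun_prop), ?_,
    coeFn_affineComp _ _ h1, ?_⟩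
  · exact hφs.comp_homeomorph ((Homeomorph.mulLeft₀ _ (sqrt_inv_ne_zero hb)).trans
      (Homeomorph.addRight (k / b)))
  · refine (Lp.coeFn_smul _ _).trans ?_
    filter_upwards [coeFn_affineComp (sqrt_inv_ne_zero hb) (k / b) h2] with y hy
    rw [Pi.smul_apply, hy, fiberExpr_scaled hb W k hφ, smul_eq_mul]

theorem mem_minimalGraph_unscaled {b : ℝ} (hb : 0 < b) {W : ℝ → ℝ} {k : ℝ} {p : L2R × L2R}
    (hp : p ∈ minimalGraph 1 (scaledPotential W b k) 0) :
    (affineComp (Real.sqrt_pos.2 hb).ne' (-(k / √b)) p.1,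
      (b : ℂ) • affineComp (Real.sqrt_pos.2 hb).ne' (-(k / √b)) p.2) ∈ minimalGraph b W k := by
  obtain ⟨ψ, hψ, hψs, h1, h2⟩ := hp
  have hs : (√b) ^ 2 = b := Real.sq_sqrt hb.le
  have hs0 : √b ≠ 0 := (Real.sqrt_pos.2 hb).ne'
  have hφ : ContDiff ℝ ∞ fun x => ψ (√b * x + -(k / √b)) := hψ.comp (by fun_prop)
  refine ⟨fun x => ψ (√b * x + -(k / √b)), hφ, ?_, coeFn_affineComp _ _ h1, ?_⟩
  · exact hψs.comp_homeomorph ((Homeomorph.mulLeft₀ _ hs0).trans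
      (Homeomorph.addRight (-(k / √b))))
  · refine (Lp.coeFn_smul _ _).trans ?_
    filter_upwards [coeFn_affineComp (Real.sqrt_pos.2 hb).ne' (-(k / √b)) h2] with x hx
    have hinv : ∀ y, √b * ((√b)⁻¹ * y + k / b) + -(k / √b) = y := fun y => by
      nth_rewrite 3 [← hs]
      field_simp
      ring
    have hinv' : (√b)⁻¹ * (√b * x + -(k / √b)) + k / b = x := by
      nth_rewrite 4 [← hs]
      field_simp
      ring
    have h3 := fiberExpr_scaled hb W k hφ (√b * x + -(k / √b))
    simp only [hinv, hinv'] at h3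
    have hbC : (b : ℂ) ≠ 0 := by exact_mod_cast hb.ne'
    rw [Pi.smul_apply, hx, h3, smul_eq_mul, mul_inv_cancel_left₀ hbC]

theorem mem_closure_minimalGraph_scaled_iff {b : ℝ} (hb : 0 < b) (W : ℝ → ℝ) (k : ℝ)
    (p : L2R × L2R) :
    p ∈ (minimalGraph b W k).topologicalClosure ↔
      (affineComp (sqrt_inv_ne_zero hb) (k / b) p.1,
        (b⁻¹ : ℂ) • affineComp (sqrt_inv_ne_zero hb) (k / b) p.2) ∈
          (minimalGraph 1 (scaledPotential W b k) 0).topologicalClosure := by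
  have hc := continuous_affineComp (sqrt_inv_ne_zero hb) (k / b)
  have hc' := continuous_affineComp (Real.sqrt_pos.2 hb).ne' (-(k / √b))
  have hs0 : √b ≠ 0 := (Real.sqrt_pos.2 hb).ne'
  constructor
  · intro hp
    refine map_mem_closure (f := fun p : L2R × L2R =>
      (affineComp (sqrt_inv_ne_zero hb) (k / b) p.1,
      (b⁻¹ : ℂ) • affineComp (sqrt_inv_ne_zero hb) (k / b) p.2)) ?_ hp
      fun q hq => mem_minimalGraph_scaled hb hq
    fun_prop
  · intro hp
    have h := map_mem_closure (f := fun p : L2R × L2R =>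
      (affineComp (Real.sqrt_pos.2 hb).ne' (-(k / √b)) p.1,
      (b : ℂ) • affineComp (Real.sqrt_pos.2 hb).ne' (-(k / √b)) p.2))
      (by fun_prop) hp
      (t := (minimalGraph b W k : Set (L2R × L2R)))
      fun q hq => mem_minimalGraph_unscaled hb hq
    have hbC : (b : ℂ) ≠ 0 := by exact_mod_cast hb.ne'
    have hcc : (√b)⁻¹ * -(k / √b) + k / b = 0 := by
      nth_rewrite 3 [← Real.sq_sqrt hb.le]
      field_simp
      ring
    simp only [map_smul, smul_smul, mul_inv_cancel₀ hbC, one_smul,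
      affineComp_affineComp (Real.sqrt_pos.2 hb).ne' (sqrt_inv_ne_zero hb) (inv_mul_cancel₀ hs0)
        hcc] at h
    exact h

theorem mem_closure_minimalGraph_eigen_iff {b : ℝ} (hb : 0 < b) {W : ℝ → ℝ} (hW : IsBddCont W)
    (k : ℝ) (p : L2R × L2R) :
    p ∈ (minimalGraph b W k).topologicalClosure ↔
      ∀ n : ℕ, (2 * n + 1) *
        inner ℂ (hermiteBasis n) (affineComp (sqrt_inv_ne_zero hb) (k / b) p.1) =
        inner ℂ (hermiteBasis n) ((b⁻¹ : ℂ) • affineComp (sqrt_inv_ne_zero hb) (k / b) p.2 -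
          mulOp (scaledPotential W b k) (affineComp (sqrt_inv_ne_zero hb) (k / b) p.1)) := by
  rw [mem_closure_minimalGraph_scaled_iff hb, mem_closure_minimalGraph_iff (hW.scaledPotential b k)]

theorem affineComp_injective {b : ℝ} (hb : 0 < b) (k : ℝ) :
    Function.Injective (affineComp (sqrt_inv_ne_zero hb) (k / b)) := by
  have hs0 : √b ≠ 0 := (Real.sqrt_pos.2 hb).ne'
  refine Function.LeftInverse.injective (g := affineComp (Real.sqrt_pos.2 hb).ne' (-(k / √b)))
    (affineComp_affineComp _ _ (inv_mul_cancel₀ hs0) ?_)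
  nth_rewrite 3 [← Real.sq_sqrt hb.le]
  field_simp
  ring

theorem affineComp_surjective {b : ℝ} (hb : 0 < b) (k : ℝ) :
    Function.Surjective (affineComp (sqrt_inv_ne_zero hb) (k / b)) := by
  have hs0 : √b ≠ 0 := (Real.sqrt_pos.2 hb).ne'
  refine Function.RightInverse.surjective (g := affineComp (Real.sqrt_pos.2 hb).ne' (-(k / √b)))
    (affineComp_affineComp _ _ (mul_inv_cancel₀ hs0) ?_)
  nth_rewrite 2 [← Real.sq_sqrt hb.le]
  field_simp
  ring

theorem graph_fiberOp {b : ℝ} (hb : 0 < b) {W : ℝ → ℝ} (hW : IsBddCont W) (k : ℝ) :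
    (fiberOp b W k).graph = (minimalGraph b W k).topologicalClosure := by
  have hfun : ∀ p ∈ (minimalGraph b W k).topologicalClosure, p.1 = 0 → p.2 = 0 := by
    intro p hp h0
    have hbC : (b⁻¹ : ℂ) ≠ 0 := by exact_mod_cast inv_ne_zero hb.ne'
    have h := (mem_closure_minimalGraph_eigen_iff hb hW k p).1 hp
    simp only [h0, map_zero, sub_zero, inner_zero_right, mul_zero, hermiteBasis_apply] at h
    have h1 := eq_zero_of_inner_hermite_eq_zero fun n => (h n).symm
    refine affineComp_injective hb k ?_
    rw [map_zero]
    exact (smul_eq_zero.1 h1).resolve_left hbC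
  have hcl : (minimalOp b W k).IsClosable :=
    ⟨(minimalGraph b W k).topologicalClosure.toLinearPMap, by
      rw [Submodule.toLinearPMap_graph_eq _ hfun, minimalOp_graph]⟩
  rw [fiberOp, ← hcl.graph_closure_eq_closure_graph, minimalOp_graph]

theorem mem_eigenvalueSet_iff {b : ℝ} (hb : 0 < b) {W : ℝ → ℝ} (hW : IsBddCont W) (k lam : ℝ) :
    lam ∈ eigenvalueSet (fiberOp b W k) ↔ ∃ u : L2R, u ≠ 0 ∧
      IsEig hermiteBasis (mulOp (scaledPotential W b k)) ((b⁻¹ * lam : ℝ) : ℂ) u := by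
  have h1 : lam ∈ eigenvalueSet (fiberOp b W k) ↔
      ∃ u : L2R, u ≠ 0 ∧ (u, (lam : ℂ) • u) ∈ (fiberOp b W k).graph := by
    constructor
    · rintro ⟨u, hu, h⟩
      exact ⟨u, hu, (LinearPMap.mem_graph_iff _).2 ⟨u, rfl, h⟩⟩
    · rintro ⟨u, hu, h⟩
      obtain ⟨v, hv, h⟩ := (LinearPMap.mem_graph_iff _).1 h
      simp only at hv h
      exact ⟨v, by rwa [hv], by rw [h, hv]⟩
  have h2 : ∀ u : L2R, (u, (lam : ℂ) • u) ∈ (fiberOp b W k).graph ↔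
      IsEig hermiteBasis (mulOp (scaledPotential W b k)) ((b⁻¹ * lam : ℝ) : ℂ)
        (affineComp (sqrt_inv_ne_zero hb) (k / b) u) := by
    intro u
    rw [graph_fiberOp hb hW, mem_closure_minimalGraph_eigen_iff hb hW]
    refine forall_congr' fun n => ?_
    rw [inner_sub_right, map_smul, smul_smul, inner_smul_right]
    push_cast
    constructor <;> intro h <;> linear_combination -h
  rw [h1]
  constructor
  · rintro ⟨u, hu, h⟩
    refine ⟨_, ?_, (h2 u).1 h⟩
    rwa [← map_zero (affineComp (sqrt_inv_ne_zero hb) (k / b)),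
      (affineComp_injective hb k).ne_iff]
  · rintro ⟨v, hv, h⟩
    obtain ⟨u, rfl⟩ := affineComp_surjective hb k v
    refine ⟨u, ?_, (h2 u).2 h⟩
    rintro rfl
    exact hv (map_zero _)

end Scaling

section Bands

open Filter Topology

theorem increasingEnum_range {E : ℕ → ℝ} (hE : StrictMono E) (n : ℕ) :
    increasingEnum (range E) n = E n := by
  induction n with
  | zero =>
    exact IsLeast.csInf_eq ⟨mem_range_self 0, by
      rintro _ ⟨m, rfl⟩; exact hE.monotone (Nat.zero_le m)⟩
  | succ n ih =>
    rw [increasingEnum, ih]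
    refine IsLeast.csInf_eq ⟨⟨mem_range_self _, hE n.lt_succ_self⟩, ?_⟩
    rintro _ ⟨⟨m, rfl⟩, hm⟩
    exact hE.monotone (Nat.succ_le_of_lt (hE.lt_iff_lt.1 hm))

theorem abs_le_supNorm {f : ℝ → ℝ} (hf : ∃ C : ℝ, ∀ x, |f x| ≤ C) (x : ℝ) : |f x| ≤ supNorm f := by
  obtain ⟨C, hC⟩ := hf
  exact le_ciSup (f := fun x => |f x|) ⟨C, by rintro _ ⟨y, rfl⟩; exact hC y⟩ x

theorem supNorm_nonneg (f : ℝ → ℝ) : 0 ≤ supNorm f := Real.iSup_nonneg fun _ => abs_nonneg _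

theorem summable_gap_int : Summable fun m : ℤ => ((2 * |(m : ℝ)| - 1) ^ 2)⁻¹ := by
  have h : Summable fun n : ℕ => ((2 * (n : ℝ) - 1) ^ 2)⁻¹ := by
    have h1 := ((summable_nat_add_iff 1).2
      (Real.summable_nat_pow_inv.2 (one_lt_two : 1 < 2))).mul_left 9
    refine Summable.of_nonneg_of_le (fun n => by positivity) (fun n => ?_) h1
    rcases n.eq_zero_or_pos with rfl | hn
    · norm_num
    · have hn1 : (1 : ℝ) ≤ n := by exact_mod_cast hn
      rw [← div_eq_mul_inv, ← inv_div]
      push_cast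
      refine inv_anti₀ (by positivity) ?_
      rw [div_le_iff₀ (by norm_num)]
      nlinarith
  refine Summable.of_nat_of_neg ?_ ?_ <;> simpa using h

theorem summable_gap (j : ℕ) : Summable fun l : ℕ+ => ((2 * |(l : ℝ) - (j : ℝ)| - 1) ^ 2)⁻¹ := by
  have hinj : Function.Injective fun l : ℕ+ => ((l : ℕ) : ℤ) - (j : ℤ) := fun l l' h => by
    simp only [sub_left_inj, Nat.cast_inj] at h
    exact PNat.eq h
  have := summable_gap_int.comp_injective hinj
  simpa [Function.comp_def] using this

theorem two_mul_le_c₁ (W : ℝ → ℝ) {j : ℕ} (hj : 1 ≤ j) :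
    2 * (supNorm W * supNorm (deriv W)) ≤ c₁ W j := by
  have h1 : (1 : ℝ) ≤ √(∑' l : ℕ+, ((2 * |(l : ℝ) - (j : ℝ)| - 1) ^ 2)⁻¹) := by
    rw [Real.one_le_sqrt]
    have := (summable_gap j).le_tsum (⟨j, hj⟩ : ℕ+) fun l _ => by positivity
    simpa using this
  have h2 : (2 : ℝ) ≤ √((∑' l : {l : ℕ+ // (l : ℕ) ≠ j},
      ((2 * |((l : ℕ+) : ℝ) - (j : ℝ)| - 3 / 2) ^ 2)⁻¹) + 4) := by
    refine Real.le_sqrt_of_sq_le ?_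
    have : 0 ≤ ∑' l : {l : ℕ+ // (l : ℕ) ≠ j},
      ((2 * |((l : ℕ+) : ℝ) - (j : ℝ)| - 3 / 2) ^ 2)⁻¹ := tsum_nonneg fun l => by positivity
    linarith
  have h0 : 0 ≤ supNorm W * supNorm (deriv W) := mul_nonneg (supNorm_nonneg _) (supNorm_nonneg _)
  rw [c₁]
  calc 2 * (supNorm W * supNorm (deriv W)) = supNorm W * supNorm (deriv W) * 1 * 2 := by ring
    _ ≤ _ := by gcongr

theorem inner_mulOp_hermiteBasis {V : ℝ → ℝ} (hV : IsBddCont V) (n : ℕ) :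
    inner ℂ (hermiteBasis n) (mulOp V (hermiteBasis n)) =
      ((∫ y, V y * hermiteFun (n + 1) y ^ 2 : ℝ) : ℂ) := by
  have h : mulOp V (polyGaussLp (hermitePoly n)) =ᵐ[volume]
      fun y => (V y : ℂ) * (polyGauss (hermitePoly n) y : ℂ) := by
    filter_upwards [coeFn_mulOp hV (polyGaussLp (hermitePoly n)),
      coeFn_polyGaussLp (hermitePoly n)] with y h1 h2
    rw [h1, h2]
  rw [hermiteBasis_apply, inner_polyGaussLp _ h, ← integral_complex_ofReal, hermiteFun_eq]
  refine integral_congr_ae (ae_of_all _ fun y => ?_)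
  push_cast
  ring

theorem integrable_abs_mul_hermiteFun_sq (n : ℕ) :
    Integrable fun y => |y| * hermiteFun (n + 1) y ^ 2 := by
  rw [hermiteFun_eq]
  have h := ((memLp_polyGauss (Polynomial.X * hermitePoly n)).integrable_mul
    (memLp_polyGauss (hermitePoly n))).abs
  refine h.congr (ae_of_all _ fun y => ?_)
  simp only [Pi.mul_apply]
  rw [← X_mul_polyGauss, mul_assoc, abs_mul, ← sq, abs_sq]

theorem abs_integral_sub_le {g : ℝ → ℝ} (hg : IsBddCont g) {C : ℝ} {x : ℝ} {a : ℝ}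
    (hC : ∀ y, |g y - x| ≤ C * (a * |y|)) (n : ℕ) :
    |(∫ y, g y * hermiteFun (n + 1) y ^ 2) - x| ≤
      C * a * ∫ y, |y| * hermiteFun (n + 1) y ^ 2 := by
  have hsq : Integrable fun y => hermiteFun (n + 1) y ^ 2 := by
    rw [hermiteFun_eq]
    exact (memLp_two_iff_integrable_sq (memLp_polyGauss _).1).1 (memLp_polyGauss _)
  have hgi : Integrable fun y => g y * hermiteFun (n + 1) y ^ 2 := by
    obtain ⟨hc, K, hK⟩ := hg
    exact hsq.bdd_mul hc.aestronglyMeasurable (ae_of_all _ hK)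
  have h1 : (∫ y, g y * hermiteFun (n + 1) y ^ 2) - x =
      ∫ y, (g y - x) * hermiteFun (n + 1) y ^ 2 := by
    have h2 : ∫ y, hermiteFun (n + 1) y ^ 2 = 1 := by
      rw [hermiteFun_eq]; exact integral_hermitePoly_sq n
    simp only [sub_mul]
    rw [integral_sub hgi (hsq.const_mul x), integral_const_mul, h2, mul_one]
  rw [h1, ← integral_const_mul, ← Real.norm_eq_abs]
  refine norm_integral_le_of_norm_le ((integrable_abs_mul_hermiteFun_sq n).const_mul _)
    (ae_of_all _ fun y => ?_)
  rw [norm_mul, Real.norm_eq_abs, Real.norm_of_nonneg (sq_nonneg _)]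
  calc _ ≤ C * (a * |y|) * hermiteFun (n + 1) y ^ 2 := by gcongr; exact hC y
    _ = _ := by ring

variable {W : ℝ → ℝ}

theorem norm_mulOp_scaledPotential_le (hW : IsBddCont W) {b : ℝ} (hb : 0 < b) (k : ℝ) :
    ‖mulOp (scaledPotential W b k)‖ ≤ supNorm W / b := by
  refine norm_mulOp_le (hW.scaledPotential b k) fun y => ?_
  rw [scaledPotential, abs_mul, abs_of_pos (inv_pos.2 hb), div_eq_inv_mul (supNorm W) b]
  gcongr
  exact abs_le_supNorm hW.2 _

/-- For `b > 2 ‖W‖`, the band functions are given by the eigenvalues of the rescaled operator. -/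
theorem exists_band_eigenvectors (hW : IsBddCont W) {b : ℝ} (hb : 2 * supNorm W < b) :
    ∃ (lam : ℕ → ℝ → ℝ) (u : ℕ → ℝ → L2R),
      (∀ n k, inner ℂ (hermiteBasis n) (u n k) = 1) ∧
      (∀ n k, ‖(lam n k : ℂ) - (2 * n + 1)‖ ≤ supNorm W / b) ∧
      (∀ n k, IsEig hermiteBasis (mulOp (scaledPotential W b k)) (lam n k) (u n k)) ∧
      ∀ n k, bandFun b W (n + 1) k = b * lam n k := by
  have hb0 : 0 < b := by linarith [supNorm_nonneg W]
  have hw : supNorm W / b < 1 / 2 := by rw [div_lt_iff₀ hb0]; linarith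
  have hA := norm_mulOp_scaledPotential_le hW hb0
  choose lam u hu hl h using fun (n : ℕ) (k : ℝ) => exists_isEig hermiteBasis
    (isSymmetric_mulOp (hW.scaledPotential b k)) hw (hA k) n
  have hu0 : ∀ n k, u n k ≠ 0 := fun n k h0 => by simpa [h0] using hu n k
  refine ⟨lam, u, hu, hl, h, fun n k => ?_⟩
  have hrange : eigenvalueSet (fiberOp b W k) = range fun m => b * lam m k := by
    ext x
    rw [mem_eigenvalueSet_iff hb0 hW]
    constructor
    · rintro ⟨v, hv, hx⟩
      obtain ⟨m, hm⟩ := hx.exists_near hermiteBasis (hA k) hv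
      refine ⟨m, ?_⟩
      have := (h m k).unique hermiteBasis hw (hA k) (hl m k) hm hx (hu0 m k) hv
      have h2 : b⁻¹ * x = lam m k := by exact_mod_cast this
      simp only [← h2, mul_inv_cancel_left₀ hb0.ne']
    · rintro ⟨m, rfl⟩
      refine ⟨u m k, hu0 m k, ?_⟩
      simp only [inv_mul_cancel_left₀ hb0.ne']
      exact h m k
  have habs : ∀ m, |lam m k - (2 * m + 1)| ≤ supNorm W / b := fun m => by
    have := hl m k
    rw [← Real.norm_eq_abs, ← Complex.norm_real]
    push_cast
    exact this
  have hmono : StrictMono fun m => b * lam m k := by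
    refine strictMono_nat_of_lt_succ fun m => ?_
    have h1 := abs_le.1 (habs m)
    have h2 := abs_le.1 (habs (m + 1))
    push_cast at h2
    have : lam m k < lam (m + 1) k := by linarith [h1.2, h2.1]
    gcongr
  rw [bandFun, hrange, Nat.add_sub_cancel, increasingEnum_range hmono]

theorem bandFun_deriv_bound (hW : ContDiff ℝ 2 W)
    (hW0 : ∃ C : ℝ, ∀ x, |W x| ≤ C) (hW1 : ∃ C : ℝ, ∀ x, |deriv W x| ≤ C)
    (hW2 : ∃ C : ℝ, ∀ x, |deriv (deriv W) x| ≤ C) {j : ℕ} (hj : 1 ≤ j) {b : ℝ}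
    (hb : 2 * supNorm W < b) (k : ℝ) :
    DifferentiableAt ℝ (bandFun b W j) k ∧
      |deriv (bandFun b W j) k - b⁻¹ * deriv W (k / b)| ≤
        c₁ W j * b ^ (-2 : ℝ) + c₂ W j * b ^ (-(3 / 2) : ℝ) := by
  have hb0 : 0 < b := by linarith [supNorm_nonneg W]
  have hw : supNorm W / b < 1 / 2 := by rw [div_lt_iff₀ hb0]; linarith
  have hWb : IsBddCont W := ⟨hW.continuous, hW0⟩
  have hc1 : ContDiff ℝ 1 (deriv W) :=
    ((contDiff_succ_iff_deriv (n := 1)).1 (by rw [one_add_one_eq_two]; exact hW)).2.2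
  obtain ⟨n, rfl⟩ : ∃ n, j = n + 1 := ⟨j - 1, by omega⟩
  obtain ⟨lam, u, hu, hl, h, hband⟩ := exists_band_eigenvectors hWb hb
  have hA := norm_mulOp_scaledPotential_le hWb hb0
  set a := (√b)⁻¹ with ha
  have hBC : IsBddCont fun y => deriv W (a * y + k / b) :=
    IsBddCont.comp_continuous ⟨hc1.continuous, hW1⟩ (g := fun y => a * y + k / b) (by fun_prop)
  set B : L2R →L[ℂ] L2R := mulOp fun y => b⁻¹ * b⁻¹ * deriv W (a * y + k / b) with hB
  have hd : HasDerivAt (lam n) _ k := hasDerivAt_of_isEig hermiteBasis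
    (A := fun t => mulOp (scaledPotential W b t)) (A' := B)
    (fun t => isSymmetric_mulOp (hWb.scaledPotential b t)) hw hA (hl n) (h n) (hu n)
    (hasDerivAt_mulOp_translate hW hW0 hW1 hW2 a b k)
  have hD : HasDerivAt (bandFun b W (n + 1))
      (b * (inner ℂ (u n k) (B (u n k)) / inner ℂ (u n k) (u n k)).re) k := by
    rw [show bandFun b W (n + 1) = fun k => b * lam n k from funext (hband n)]
    exact hd.const_mul b
  refine ⟨hD.differentiableAt, ?_⟩
  rw [hD.deriv]
  have hBn : ‖B‖ ≤ b⁻¹ * b⁻¹ * supNorm (deriv W) := by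
    refine norm_mulOp_le (hBC.const_mul _) fun y => ?_
    rw [abs_mul, abs_of_pos (by positivity)]
    gcongr
    exact abs_le_supNorm hW1 _
  have h1 := (h n k).expectation_sub_le hermiteBasis hw (hA k) (hl n k) (hu n k) B
  rw [hB, inner_mulOp_hermiteBasis (hBC.const_mul _), ← hB] at h1
  have h2 := (Complex.abs_re_le_norm _).trans h1
  rw [Complex.sub_re, Complex.ofReal_re] at h2
  simp only [mul_assoc (b⁻¹ * b⁻¹)] at h2
  rw [integral_const_mul] at h2
  have h3 := abs_integral_sub_le hBC (C := supNorm (deriv (deriv W))) (x := deriv W (k / b))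
    (a := a) (fun y => by
      have := abs_sub_le_of_abs_deriv_le (hc1.differentiable (by simp)) (abs_le_supNorm hW2)
        (k / b) (a * y + k / b)
      rwa [add_sub_cancel_right, abs_mul, abs_of_pos (by positivity : 0 < a)] at this) n
  set r := (inner ℂ (u n k) (B (u n k)) / inner ℂ (u n k) (u n k)).re
  set I := ∫ y, deriv W (a * y + k / b) * hermiteFun (n + 1) y ^ 2
  have e1 : b * r - b⁻¹ * deriv W (k / b) =
      b * (r - b⁻¹ * b⁻¹ * I) + b⁻¹ * (I - deriv W (k / b)) := by
    field_simp
    ring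
  have e2 : b ^ (-2 : ℝ) = b⁻¹ * b⁻¹ := by
    rw [Real.rpow_neg hb0.le, Real.rpow_two, sq, mul_inv]
  have e3 : b ^ (-(3 / 2) : ℝ) = b⁻¹ * a := by
    rw [ha, Real.sqrt_eq_rpow, ← Real.rpow_neg_one b, ← Real.rpow_neg hb0.le,
      ← Real.rpow_add hb0]
    norm_num
  rw [e1, e2, e3]
  refine (abs_add_le _ _).trans (add_le_add ?_ ?_)
  · rw [abs_mul, abs_of_pos hb0]
    calc b * |r - b⁻¹ * b⁻¹ * I|
        ≤ b * (2 * (supNorm W / b) * (b⁻¹ * b⁻¹ * supNorm (deriv W))) := by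
          gcongr
          refine h2.trans ?_
          have := supNorm_nonneg W
          gcongr
      _ = 2 * (supNorm W * supNorm (deriv W)) * (b⁻¹ * b⁻¹) := by field_simp
      _ ≤ _ := by gcongr; exact two_mul_le_c₁ W hj
  · rw [abs_mul, abs_of_pos (inv_pos.2 hb0), c₂]
    refine (mul_le_mul_of_nonneg_left h3 (inv_pos.2 hb0).le).trans_eq ?_
    ring

theorem exists_forall_error_lt (M A B : ℝ) {d : ℝ} (hd : 0 < d) :
    ∃ b₀ : ℝ, 0 < b₀ ∧ ∀ b : ℝ, b₀ < b →
      M < b ∧ A * b ^ (-2 : ℝ) + B * b ^ (-(3 / 2) : ℝ) < b⁻¹ * d := by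
  have h1 : Tendsto (fun b : ℝ => A * b ^ (-1 : ℝ) + B * b ^ (-(1 / 2) : ℝ)) atTop (𝓝 0) := by
    have := ((tendsto_rpow_neg_atTop one_pos).const_mul A).add
      ((tendsto_rpow_neg_atTop (one_half_pos (α := ℝ))).const_mul B)
    simpa using this
  obtain ⟨b₁, hb₁⟩ := eventually_atTop.1 (h1.eventually_lt_const hd)
  refine ⟨max 1 (max M b₁), by positivity, fun b hb => ?_⟩
  simp only [max_lt_iff] at hb
  have hb0 : 0 < b := by linarith
  refine ⟨hb.2.1, ?_⟩
  have e1 : b ^ (-2 : ℝ) = b⁻¹ * b ^ (-1 : ℝ) := by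
    rw [← Real.rpow_neg_one b, ← Real.rpow_add hb0]; norm_num
  have e2 : b ^ (-(3 / 2) : ℝ) = b⁻¹ * b ^ (-(1 / 2) : ℝ) := by
    rw [← Real.rpow_neg_one b, ← Real.rpow_add hb0]; norm_num
  calc _ = b⁻¹ * (A * b ^ (-1 : ℝ) + B * b ^ (-(1 / 2) : ℝ)) := by rw [e1, e2]; ring
    _ < _ := by
      have := hb₁ b hb.2.2.le
      gcongr

end Bands

end EdgePotential

theorem mainTheorem6 (W : ℝ → ℝ) (hW : ContDiff ℝ 2 W)
    (hW0 : ∃ C : ℝ, ∀ x, |W x| ≤ C) (hW1 : ∃ C : ℝ, ∀ x, |deriv W x| ≤ C)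
    (hW2 : ∃ C : ℝ, ∀ x, |deriv (deriv W) x| ≤ C) (j : ℕ) (hj : 1 ≤ j) :
    (∀ x₀ : ℝ, 0 < deriv W x₀ → ∃ b₀ : ℝ, 0 < b₀ ∧ ∀ b : ℝ, b₀ < b →
      DifferentiableAt ℝ (EdgePotential.bandFun b W j) (b * x₀) ∧
        0 < deriv (EdgePotential.bandFun b W j) (b * x₀)) ∧
    (∀ x₀ : ℝ, deriv W x₀ < 0 → ∃ b₀ : ℝ, 0 < b₀ ∧ ∀ b : ℝ, b₀ < b →
      DifferentiableAt ℝ (EdgePotential.bandFun b W j) (b * x₀) ∧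
        deriv (EdgePotential.bandFun b W j) (b * x₀) < 0) ∧
    (∀ b : ℝ, 2 * EdgePotential.supNorm W < b → ∀ k : ℝ,
      DifferentiableAt ℝ (EdgePotential.bandFun b W j) k ∧
        |deriv (EdgePotential.bandFun b W j) k - b⁻¹ * deriv W (k / b)| ≤
          EdgePotential.c₁ W j * b ^ (-2 : ℝ) + EdgePotential.c₂ W j * b ^ (-(3 / 2) : ℝ)) := by
  refine ⟨fun x₀ hx₀ => ?_, fun x₀ hx₀ => ?_,
    fun b hb k => EdgePotential.bandFun_deriv_bound hW hW0 hW1 hW2 hj hb k⟩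
  · obtain ⟨b₀, hb₀, h⟩ := EdgePotential.exists_forall_error_lt (2 * EdgePotential.supNorm W)
      (EdgePotential.c₁ W j) (EdgePotential.c₂ W j) hx₀
    refine ⟨b₀, hb₀, fun b hb => ?_⟩
    obtain ⟨h1, h2⟩ := h b hb
    obtain ⟨hd, h3⟩ := EdgePotential.bandFun_deriv_bound hW hW0 hW1 hW2 hj h1 (b * x₀)
    rw [mul_div_cancel_left₀ _ (hb₀.trans hb).ne'] at h3
    exact ⟨hd, by linarith [(abs_le.1 h3).1]⟩
  · obtain ⟨b₀, hb₀, h⟩ := EdgePotential.exists_forall_error_lt (2 * EdgePotential.supNorm W)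
      (EdgePotential.c₁ W j) (EdgePotential.c₂ W j) (neg_pos.2 hx₀)
    refine ⟨b₀, hb₀, fun b hb => ?_⟩
    obtain ⟨h1, h2⟩ := h b hb
    obtain ⟨hd, h3⟩ := EdgePotential.bandFun_deriv_bound hW hW0 hW1 hW2 hj h1 (b * x₀)
    rw [mul_div_cancel_left₀ _ (hb₀.trans hb).ne'] at h3
    exact ⟨hd, by linarith [(abs_le.1 h3).2]⟩
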